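/- For an integer $k\ge 3$ consider the Hecke group $\Gamma_k=\mathbb Z/2\mathbb Z\star\mathbb Z/k\mathbb Z$, with $a$ and $b$ the generators of the two cyclic factors. Put $\Sigma=\{a,b,b^2,\dots,b^{k-1}\}$, $\Sigma_a=\{a\}$, $\Sigma_b=\Sigma_{b^i}=\{b,\dots,b^{k-1}\}$. Every element of $\Gamma_k$ has a unique normal form, a word over $\Sigma$ in which letters $a$ and letters $b^i$ alternate; let $|g|$ denote the length of the normal form of $g$. Let $X_0=1$, $X_{n+1}=X_n\xi_n$ be the simple random walk, where the $\xi_n$ are i.i.d. with law $\mu(a)=\mu(b)=\mu(b^{-1})=1/3$. Its harmonic measure is the law on $\Sigma^{\mathbb N}$ of the infinite word $X_\infty$ to which the normal forms of the $X_n$ converge almost surely (letter by letter), and its drift is $\gamma_k=\lim_n |X_n|/n$, the limit being almost sure and in $L^1$. For $r:\Sigma\to(0,\infty)$ with $\sum_{u\in\Sigma} r(u)=1$, the Markovian multiplicative measure associated with $r$ is the law on $\Sigma^{\mathbb N}$ of the Markov chain with initial law $r$ and transition matrix $P_{u,v}=r(v)/\sum_{w\in\Sigma\setminus\Sigma_u}r(w)$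 if $v\notin\Sigma_u$, and $P_{u,v}=0$ otherwise. Define $G_0(x)=\frac14+\frac x2$, $G_1(x)=x$ and, for $n\ge 2$, $$G_n(x)=\frac{8(1-x)}{3-2x}\,G_{n-1}(x)-G_{n-2}(x),\qquad x\in[0,1].$$ **Theorem.** For every $k\ge 3$ the equation $G_{k-1}(y)=y$ has a unique solution $y_k$ in $(0,1/2)$. The harmonic measure and the drift of the simple random walk on $\Gamma_k$ exist. The harmonic measure is the Markovian multiplicative measure associated with $$r(a)=G_0(y_k),\qquad r(b^i)=G_i(y_k)\quad(1\le i\le k-1),$$ where this $r$ is a positive probability vector. The drift is $\gamma_k=\dfrac{1-2y_k}{3}$; it is strictly increasing in $k$ ($k\ge 3$), and $\lim_{k\to\infty}\gamma_k=\dfrac29$. -/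

import Mathlib

open MeasureTheory Filter Topology Set

noncomputable section

namespace FreeProductWalk

section General

variable {ι : Type} [DecidableEq ι] {G : ι → Type} [∀ i, Group (G i)] [∀ i, DecidableEq (G i)]

/-- The free product of groups is discrete: every subset is measurable. -/
instance instMeasurableSpaceCoprodI : MeasurableSpace (Monoid.CoprodI G) := ⊤

variable (G) in
/-- The alphabet `Σ`: the disjoint union of the sets `Σ_i = G i \ {1}`. -/
def Letter : Type := {x : Σ i, G i // x.2 ≠ 1}

instance instMeasurableSpaceLetter : MeasurableSpace (Letter G) := ⊤

/-- The index `i` of the factor `G i` that a letter comes from. -/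
def Letter.factor (u : Letter G) : ι := u.1.1

/-- The normal form of an element `g` of the free product: the unique word `u₁ ⋯ u_m` of
non-identity elements, consecutive ones from distinct factors, whose product is `g`. -/
def normalForm (g : Monoid.CoprodI G) : List (Σ i, G i) :=
  (Monoid.CoprodI.Word.equiv g).toList

/-- The word length with respect to the generating set `Σ`. -/
def wordLength (g : Monoid.CoprodI G) : ℕ := (normalForm g).length

/-- Position at time `n`, started at `1`, with increments `ω 0, ω 1, …`:
`X 0 = 1` and `X (n + 1) = X n * ω n`. -/
def walk (ω : ℕ → Monoid.CoprodI G) : ℕ → Monoid.CoprodI G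
  | 0 => 1
  | n + 1 => walk ω n * ω n

/-- The law of an i.i.d. sequence of increments with common law `μ`. -/
def incrementLaw (μ : Measure (Monoid.CoprodI G)) [IsProbabilityMeasure μ] :
    Measure (ℕ → Monoid.CoprodI G) :=
  Measure.infinitePi (fun _ : ℕ => μ)

/-- The sequence `g` of group elements converges to the infinite word `ξ`: for each position
`m`, the letter number `m` of the normal form of `g n` is eventually `ξ m`. -/
def TendsToInfiniteWord (g : ℕ → Monoid.CoprodI G) (ξ : ℕ → Letter G) : Prop :=
  ∀ m : ℕ, ∀ᶠ n in atTop, (normalForm (g n))[m]? = some (ξ m).1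

/-- `ν` is the harmonic measure of the random walk with step law `μ`: almost surely the walk
converges to a random infinite word, and `ν` is the law of that limit. -/
def IsHarmonicMeasure (μ : Measure (Monoid.CoprodI G)) [IsProbabilityMeasure μ]
    (ν : Measure (ℕ → Letter G)) : Prop :=
  ∃ Xinf : (ℕ → Monoid.CoprodI G) → (ℕ → Letter G), Measurable Xinf ∧
    (∀ᵐ ω ∂(incrementLaw μ), TendsToInfiniteWord (walk ω) (Xinf ω)) ∧
    (incrementLaw μ).map Xinf = ν

/-- `γ` is the drift of the random walk with step law `μ`: the limit of `|X n| / n`,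
almost surely and in `L¹`. -/
def HasDrift (μ : Measure (Monoid.CoprodI G)) [IsProbabilityMeasure μ] (γ : ℝ) : Prop :=
  (∀ᵐ ω ∂(incrementLaw μ),
    Tendsto (fun n : ℕ => (wordLength (walk ω n) : ℝ) / n) atTop (𝓝 γ)) ∧
  Tendsto (fun n : ℕ => ∫⁻ ω, ENNReal.ofReal |(wordLength (walk ω n) : ℝ) / n - γ|
    ∂(incrementLaw μ)) atTop (𝓝 0)

/-- The transition matrix attached to `r`: from `u` one jumps to a letter `v` of another factor,
chosen with probability proportional to `r v`. -/
def transition (r : Letter G → ℝ) (u v : Letter G) : ℝ :=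
  if v.factor = u.factor then 0
  else r v / ∑' w : {w : Letter G // w.factor ≠ u.factor}, r w.1

/-- `ν` is the Markovian multiplicative measure associated with the positive probability vector
`r`: the law of the Markov chain on `Σ` with initial law `r` and matrix `transition r`. -/
def IsMarkovianMultiplicative (r : Letter G → ℝ) (ν : Measure (ℕ → Letter G)) : Prop :=
  (∀ u, 0 < r u) ∧ HasSum r 1 ∧ IsProbabilityMeasure ν ∧
    ∀ (n : ℕ) (u : ℕ → Letter G),
      ν {ξ | ∀ j ≤ n, ξ j = u j} =
        ENNReal.ofReal (r (u 0) * ∏ j ∈ Finset.range n, transition r (u j) (u (j + 1)))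

end General

section Hecke

/-- The orders of the two cyclic factors. -/
def heckeOrder (k : ℕ) : Bool → ℕ
  | false => 2
  | true => k

/-- The two cyclic factors `ℤ/2ℤ` and `ℤ/kℤ`, written multiplicatively. -/
abbrev HeckeFactor (k : ℕ) (i : Bool) : Type := Multiplicative (ZMod (heckeOrder k i))

/-- The Hecke group `ℤ/2ℤ ⋆ ℤ/kℤ`. -/
abbrev HeckeGroup (k : ℕ) : Type := Monoid.CoprodI (HeckeFactor k)

/-- The generator of the factor `ℤ/2ℤ`. -/
def genA (k : ℕ) : HeckeGroup k :=
  Monoid.CoprodI.of (M := HeckeFactor k) (i := false) (Multiplicative.ofAdd 1)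

/-- The generator of the factor `ℤ/kℤ`. -/
def genB (k : ℕ) : HeckeGroup k :=
  Monoid.CoprodI.of (M := HeckeFactor k) (i := true) (Multiplicative.ofAdd 1)

/-- The step law of the simple random walk: mass `1/3` at each of `a`, `b`, `b⁻¹`. -/
def heckeStep (k : ℕ) : Measure (HeckeGroup k) :=
  (3 : ENNReal)⁻¹ • (Measure.dirac (genA k) + Measure.dirac (genB k) + Measure.dirac (genB k)⁻¹)

instance heckeStep_isProbabilityMeasure (k : ℕ) : IsProbabilityMeasure (heckeStep k) := by
  constructor
  simp only [heckeStep, Measure.smul_apply, Measure.add_apply, measure_univ, smul_eq_mul]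
  rw [show (1 + 1 + 1 : ENNReal) = 3 by norm_num]
  exact ENNReal.inv_mul_cancel (by norm_num) (by norm_num)

/-- The functions `G_n`. -/
def heckeG : ℕ → ℝ → ℝ
  | 0, x => 1 / 4 + x / 2
  | 1, x => x
  | n + 2, x => 8 * (1 - x) / (3 - 2 * x) * heckeG (n + 1) x - heckeG n x

/-- The vector `r` with `r(a) = G_0(y)` and `r(b^i) = G_i(y)` for `1 ≤ i ≤ k - 1`. -/
def heckeWeight (k : ℕ) (y : ℝ) (u : Letter (HeckeFactor k)) : ℝ :=
  if u.factor = false then heckeG 0 y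
  else heckeG (ZMod.val (Multiplicative.toAdd u.1.2)) y

end Hecke

end FreeProductWalk

end

/-!
The idea is to guess, for a probability vector `r` on the letters, the probability that the walk
ever visits a given element `g`: the product, over the letters `x` of `g`, of `r x` divided by the
total weight of the letters outside the factor of `x`. A step of length one disturbs only the first
letter, so this product is harmonic off the identity as soon as it is so at the words of length one.
It gives rise to a bounded harmonic function whose limit along the walk is the indicator of the
infinite words with a given prefix, and its value at `1` is then the harmonic measure of that
cylinder.

The drift comes from the horofunction `|h⁻¹ ξ| - |ξ|` averaged over the multiplicative law of `ξ`.
It differs from the word length of `h` by a bounded amount and has constant mean increment under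
the walk, so its deviations are sub-Gaussian and, by Borel–Cantelli, `|X n| / n` converges to that
increment.

For the Hecke group the equations at the words of length one become the recursion defining
`heckeG`. With `8 (1 - y) / (3 - 2 y) = l + l⁻¹`, the condition `G_{k-1}(y) = y` says that `G_n(y)`
is proportional to `l ^ n + l ^ (k - n)` and has total mass one over `0 ≤ n < k`. This mass is
strictly increasing in both `l` and `k`, and its limit as `k → ∞` equals one at `l = 1 / 2`, that
is, at `y = 1 / 6`.
-/

noncomputable section

namespace FreeProductWalk

open ProbabilityTheory
open Monoid (CoprodI)
open scoped NNReal

/-! ### The recursion defining `heckeG` -/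

section CyclicRecursion

/-- The solution of `x (n + 2) = (l + l⁻¹) * x (n + 1) - x n` with `x 0 = x k = 1`. It is
a ratio of hyperbolic cosines, symmetric under `n ↦ k - n`. -/
def cyclicProfile (k : ℕ) (l : ℝ) (n : ℕ) : ℝ := (l ^ n + l ^ k * l⁻¹ ^ n) / (1 + l ^ k)

variable {k n : ℕ} {l : ℝ}

lemma cyclicProfile_eq (hl : l ≠ 0) (hn : n ≤ k) :
    cyclicProfile k l n = (l ^ n + l ^ (k - n)) / (1 + l ^ k) := by
  rw [cyclicProfile, inv_pow, pow_sub₀ l hl hn]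

lemma cyclicProfile_zero (hl : 0 < l) : cyclicProfile k l 0 = 1 := by
  have : 1 + l ^ k ≠ 0 := by positivity
  simp [cyclicProfile, this]

lemma cyclicProfile_pos (hl : 0 < l) : 0 < cyclicProfile k l n := by
  unfold cyclicProfile; positivity

lemma cyclicProfile_sub (hl : l ≠ 0) (hn : n ≤ k) :
    cyclicProfile k l (k - n) = cyclicProfile k l n := by
  rw [cyclicProfile_eq hl hn, cyclicProfile_eq hl (k.sub_le n), Nat.sub_sub_self hn, add_comm]

lemma cyclicProfile_add_two (k : ℕ) (hl : l ≠ 0) (n : ℕ) :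
    cyclicProfile k l (n + 2) = (l + l⁻¹) * cyclicProfile k l (n + 1) - cyclicProfile k l n := by
  simp only [cyclicProfile]
  linear_combination -((l ^ n + l ^ k * l⁻¹ ^ n) / (1 + l ^ k)) * mul_inv_cancel₀ hl

lemma one_sub_cyclicProfile (hl : 0 < l) (hn : n ≤ k) :
    1 - cyclicProfile k l n = (1 - l ^ n) * (1 - l ^ (k - n)) / (1 + l ^ k) := by
  have : 1 + l ^ k ≠ 0 := by positivity
  rw [cyclicProfile_eq hl.ne' hn, one_sub_div this, ← Nat.add_sub_cancel' hn, pow_add,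
    Nat.add_sub_cancel_left]
  ring

lemma cyclicProfile_lt_one (hl : l ∈ Ioo 0 1) (hn : n ∈ Ioo 0 k) : cyclicProfile k l n < 1 := by
  have one_sub_pow_pos {m : ℕ} (hm : m ≠ 0) : 0 < 1 - l ^ m :=
    sub_pos.2 (pow_lt_one₀ hl.1.le hl.2 hm)
  rw [← sub_pos, one_sub_cyclicProfile hl.1 hn.2.le]
  exact div_pos (mul_pos (one_sub_pow_pos hn.1.ne') (one_sub_pow_pos (Nat.sub_ne_zero_of_lt hn.2)))
    (add_pos one_pos (pow_pos hl.1 k))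

lemma cyclicProfile_monotoneOn (hn : n ≤ k) :
    MonotoneOn (fun l => cyclicProfile k l n) (Ioc 0 1) := by
  intro l hl u hu hlu
  rw [← sub_le_sub_iff_left 1, one_sub_cyclicProfile hl.1 hn, one_sub_cyclicProfile hu.1 hn]
  have one_sub_pow_nonneg {x : ℝ} (hx : x ∈ Ioc 0 1) (m : ℕ) : 0 ≤ 1 - x ^ m :=
    sub_nonneg.2 (pow_le_one₀ hx.1.le hx.2)
  have := hl.1.le
  have := hl.1
  gcongr
  exacts [mul_nonneg (one_sub_pow_nonneg hl _) (one_sub_pow_nonneg hl _),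
    one_sub_pow_nonneg hu _, one_sub_pow_nonneg hl _]

lemma sum_cyclicProfile (k : ℕ) (hl : l ≠ 0) :
    ∑ n ∈ Finset.range k, cyclicProfile k l n =
      (1 + l) * (∑ n ∈ Finset.range k, l ^ n) / (1 + l ^ k) := by
  have : ∑ n ∈ Finset.range k, l ^ (k - n) = l * ∑ n ∈ Finset.range k, l ^ n := by
    rw [← Finset.sum_range_reflect, Finset.mul_sum]
    refine Finset.sum_congr rfl fun n hn => ?_
    rw [← pow_succ', show k - (k - 1 - n) = n + 1 by have := Finset.mem_range.1 hn; omega]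
  rw [Finset.sum_congr rfl fun n hn => cyclicProfile_eq hl (Finset.mem_range.1 hn).le,
    ← Finset.sum_div, Finset.sum_add_distrib, this]
  ring

lemma eq_of_recursion {x x' : ℕ → ℝ} {c : ℝ} (hx : ∀ n, x (n + 2) = c * x (n + 1) - x n)
    (hx' : ∀ n, x' (n + 2) = c * x' (n + 1) - x' n) (h₀ : x 0 = x' 0) (h₁ : x 1 = x' 1)
    (n : ℕ) : x n = x' n := by
  induction n using Nat.twoStepInduction with
  | zero => exact h₀
  | one => exact h₁
  | more n ih ih' => rw [hx, hx', ih, ih']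

lemma pow_mul_eq_sum_of_recursion {d : ℕ → ℝ} (hl : l ≠ 0) (h₀ : d 0 = 0)
    (h : ∀ n, d (n + 2) = (l + l⁻¹) * d (n + 1) - d n) (n : ℕ) :
    l ^ n * d (n + 1) = (∑ j ∈ Finset.range (n + 1), l ^ (2 * j)) * d 1 := by
  have first_order : ∀ n, d (n + 2) = l⁻¹ * d (n + 1) + l ^ (n + 1) * d 1 := by
    intro n
    induction n with
    | zero => rw [h, h₀]; ring
    | succ n ih =>
      rw [h, ih]
      field_simp
      ring
  induction n with
  | zero => simp
  | succ n ih =>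
    rw [first_order, Finset.sum_range_succ, add_mul, ← ih]
    field_simp
    ring

lemma eq_mul_cyclicProfile {x : ℕ → ℝ} (hk : 3 ≤ k) (hl₀ : 0 < l) (hl₁ : l ≤ 1)
    (hx : ∀ n, x (n + 2) = (l + l⁻¹) * x (n + 1) - x n) (h : x (k - 1) = x 1) (n : ℕ) :
    x n = x 0 * cyclicProfile k l n := by
  let d n := x n - x 0 * cyclicProfile k l n
  have d_rec (n : ℕ) : d (n + 2) = (l + l⁻¹) * d (n + 1) - d n := by
    simp only [d, hx, cyclicProfile_add_two k hl₀.ne']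
    ring
  have d_zero : d 0 = 0 := by simp [d, cyclicProfile_zero hl₀]
  obtain ⟨m, rfl⟩ := Nat.exists_eq_add_of_le' hk
  have d_symm : d (m + 2) = d 1 := by
    have := cyclicProfile_sub hl₀.ne' (show 1 ≤ m + 3 by omega)
    simp only [show m + 3 - 1 = m + 2 by omega] at this h
    simp only [d, this, h]
  have d_one : d 1 = 0 := by
    have hsum := pow_mul_eq_sum_of_recursion hl₀.ne' d_zero d_rec (m + 1)
    rw [d_symm, Finset.sum_range_succ'] at hsum
    have hlt : l ^ (m + 1) < ∑ j ∈ Finset.range (m + 1), l ^ (2 * (j + 1)) + l ^ (2 * 0) := by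
      have : 0 < ∑ j ∈ Finset.range (m + 1), l ^ (2 * (j + 1)) :=
        Finset.sum_pos (fun _ _ => by positivity) (by simp)
      have := pow_le_one₀ hl₀.le hl₁ (n := m + 1)
      simp only [mul_zero, pow_zero]
      linarith
    exact (mul_eq_mul_right_iff.1 hsum).resolve_left hlt.ne
  exact sub_eq_zero.1 (eq_of_recursion (x' := 0) d_rec (by simp) d_zero d_one n)

end CyclicRecursion

section RootParam

/-- The parametrization of `y` by the root `l < 1` of the characteristic equation
`8 * (1 - y) / (3 - 2 * y) = l + l⁻¹` of the recursion that defines `heckeG`. -/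
def rootParam (l : ℝ) : ℝ := (8 * l - 3 * l ^ 2 - 3) / (2 * (l * (4 - l) - 1))

/-- The mass that `heckeG` gives to `{0, …, k - 1}` when it has the shape of a
`cyclicProfile`; the solutions of `G_{k-1}(y) = y` are the parameters of mass one. -/
def profileMass (k : ℕ) (l : ℝ) : ℝ :=
  heckeG 0 (rootParam l) * ∑ n ∈ Finset.range k, cyclicProfile k l n

variable {k n : ℕ} {l y : ℝ}

lemma rootParam_denom_pos (hl : l ∈ Ioc (2 / 5) 1) : 0 < l * (4 - l) - 1 := by
  nlinarith [hl.1, hl.2]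

lemma rootParam_strictMonoOn : StrictMonoOn rootParam (Ioc (2 / 5) 1) := by
  intro l hl u hu hlu
  have hlt : l * u < 1 := by nlinarith [hl.1, hl.2, hu.1, hu.2]
  unfold rootParam
  rw [div_lt_div_iff₀ (by linarith [rootParam_denom_pos hl])
    (by linarith [rootParam_denom_pos hu])]
  nlinarith [mul_pos (sub_pos.2 hlu) (sub_pos.2 hlt)]

lemma continuousOn_rootParam : ContinuousOn rootParam (Icc (2 / 5) 1) := by
  refine ContinuousOn.div (by fun_prop) (by fun_prop) fun l hl => ne_of_gt ?_
  nlinarith [hl.1, hl.2]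

lemma rootParam_half : rootParam (1 / 2) = 1 / 6 := by norm_num [rootParam]

lemma rootParam_one : rootParam 1 = 1 / 2 := by norm_num [rootParam]

lemma rootParam_mem_Ioo (hl : l ∈ Ioo (1 / 2) 1) : rootParam l ∈ Ioo 0 (1 / 2) := by
  have hl' : l ∈ Ioc (2 / 5) 1 := ⟨by linarith [hl.1], hl.2.le⟩
  constructor
  · have := rootParam_strictMonoOn (by norm_num) hl' hl.1
    rw [rootParam_half] at this
    linarith
  · simpa only [rootParam_one] using rootParam_strictMonoOn hl' (by norm_num) hl.2

lemma exists_rootParam_eq (hy : y ∈ Ioo 0 (1 / 2)) : ∃ l ∈ Ioo (2 / 5) 1, rootParam l = y := by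
  refine intermediate_value_Ioo (by norm_num) continuousOn_rootParam ⟨?_, ?_⟩
  · exact lt_trans (by norm_num [rootParam]) hy.1
  · rw [rootParam_one]; exact hy.2

lemma heckeG_rootParam_add_two (hl : l ∈ Ioc (2 / 5) 1) (n : ℕ) :
    heckeG (n + 2) (rootParam l) =
      (l + l⁻¹) * heckeG (n + 1) (rootParam l) - heckeG n (rootParam l) := by
  have hd := (rootParam_denom_pos hl).ne'
  have hl₀ : l ≠ 0 := by linarith [hl.1]
  have hden : 3 - 2 * rootParam l = 4 * l / (l * (4 - l) - 1) := by
    rw [rootParam]; field_simp; ring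
  rw [heckeG, hden, rootParam]
  congr 2
  field_simp
  ring

lemma heckeG_zero_rootParam (hl : l ∈ Ioc (2 / 5) 1) :
    heckeG 0 (rootParam l) = (l * (3 - l) - 1) / (l * (4 - l) - 1) := by
  have hd := (rootParam_denom_pos hl).ne'
  rw [heckeG, rootParam]
  field_simp
  ring

lemma heckeG_zero_rootParam_pos (hl : l ∈ Ioc (2 / 5) 1) : 0 < heckeG 0 (rootParam l) := by
  rw [heckeG_zero_rootParam hl]
  exact div_pos (by nlinarith [hl.1, hl.2]) (rootParam_denom_pos hl)

lemma profileMass_eq_one_iff (hk : 1 ≤ k) (hl : l ∈ Ioo (2 / 5) 1) :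
    profileMass k l = 1 ↔
      heckeG 1 (rootParam l) = heckeG 0 (rootParam l) * cyclicProfile k l 1 := by
  have hl' := Ioo_subset_Ioc_self hl
  have hl₀ : 0 < l := by linarith [hl.1]
  have hd := rootParam_denom_pos hl'
  have hd' : 0 < 1 + l ^ k := by positivity
  have h1 : 1 - l ≠ 0 := by linarith [hl.2]
  have hgeom : ∑ n ∈ Finset.range k, l ^ n = (1 - l ^ k) / (1 - l) := by
    rw [geom_sum_eq hl.2.ne, ← neg_div_neg_eq, neg_sub, neg_sub]
  have key : (profileMass k l - 1) * (1 - l) ^ 2 =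
      2 * l * (heckeG 1 (rootParam l) - heckeG 0 (rootParam l) * cyclicProfile k l 1) := by
    obtain ⟨m, rfl⟩ := Nat.exists_eq_add_of_le' hk
    rw [profileMass, sum_cyclicProfile _ hl₀.ne', hgeom, heckeG_zero_rootParam hl', heckeG,
      rootParam, cyclicProfile_eq hl₀.ne' hk, Nat.add_sub_cancel]
    field_simp
    ring
  rw [← sub_eq_zero, ← sub_eq_zero (a := heckeG 1 _), ← mul_eq_zero_iff_right (pow_ne_zero 2 h1),
    key, mul_eq_zero_iff_left (by positivity)]

lemma heckeG_rootParam_eq_mul_cyclicProfile (hk : 3 ≤ k) (hl : l ∈ Ioc (2 / 5) 1)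
    (h : heckeG (k - 1) (rootParam l) = rootParam l) (n : ℕ) :
    heckeG n (rootParam l) = heckeG 0 (rootParam l) * cyclicProfile k l n :=
  eq_mul_cyclicProfile (x := fun n => heckeG n (rootParam l)) hk (by linarith [hl.1]) hl.2
    (heckeG_rootParam_add_two hl) h n

lemma heckeG_eq_self_iff (hk : 3 ≤ k) (hl : l ∈ Ioo (2 / 5) 1) :
    heckeG (k - 1) (rootParam l) = rootParam l ↔ profileMass k l = 1 := by
  have hl' := Ioo_subset_Ioc_self hl
  have hl₀ : 0 < l := by linarith [hl.1]
  rw [profileMass_eq_one_iff (by omega) hl]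
  refine ⟨fun h => heckeG_rootParam_eq_mul_cyclicProfile hk hl' h 1, fun h => ?_⟩
  have hG : ∀ n, heckeG n (rootParam l) = heckeG 0 (rootParam l) * cyclicProfile k l n := by
    refine eq_of_recursion (c := l + l⁻¹) (heckeG_rootParam_add_two hl') (fun n => ?_) ?_ h
    · rw [cyclicProfile_add_two k hl₀.ne']; ring
    · rw [cyclicProfile_zero hl₀, mul_one]
  rw [hG, cyclicProfile_sub hl₀.ne' (by omega), ← h, heckeG]

lemma profileMass_strictMonoOn (hk : 0 < k) : StrictMonoOn (profileMass k) (Ioc (2 / 5) 1) := by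
  intro l hl u hu hlu
  have hl₀ : 0 < l := by linarith [hl.1]
  have hu₀ : 0 < u := by linarith [hu.1]
  have hy := rootParam_strictMonoOn hl hu hlu
  refine mul_lt_mul (by simp only [heckeG]; linarith) (Finset.sum_le_sum fun n hn => ?_)
    (Finset.sum_pos (fun n _ => cyclicProfile_pos hl₀) (by simpa using hk.ne'))
    (heckeG_zero_rootParam_pos hu).le
  exact cyclicProfile_monotoneOn (Finset.mem_range.1 hn).le ⟨hl₀, hl.2⟩ ⟨hu₀, hu.2⟩ hlu.le

lemma continuousOn_profileMass (k : ℕ) : ContinuousOn (profileMass k) (Icc (1 / 2) 1) := by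
  have hy : ContinuousOn rootParam (Icc (1 / 2) 1) :=
    continuousOn_rootParam.mono (Icc_subset_Icc_left (by norm_num))
  have hsum (l : ℝ) (hl : l ∈ Icc (1 / 2) 1) : ∑ n ∈ Finset.range k, cyclicProfile k l n =
      (1 + l) * (∑ n ∈ Finset.range k, l ^ n) / (1 + l ^ k) :=
    sum_cyclicProfile k (by linarith [hl.1])
  refine ContinuousOn.mul ?_ (ContinuousOn.congr ?_ hsum)
  · simp only [heckeG]; fun_prop
  · refine ContinuousOn.div (by fun_prop) (by fun_prop) fun l hl => ne_of_gt ?_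
    have : 0 ≤ l := by linarith [hl.1]
    positivity

lemma profileMass_eq (k : ℕ) (hl : l ∈ Ioo (2 / 5) 1) :
    profileMass k l = heckeG 0 (rootParam l) * ((1 + l) / (1 - l)) * (2 / (1 + l ^ k) - 1) := by
  have hl₀ : 0 < l := by linarith [hl.1]
  have hd : 1 + l ^ k ≠ 0 := by positivity
  have h1 : 1 - l ≠ 0 := by linarith [hl.2]
  have h1' : l - 1 ≠ 0 := by linarith [hl.2]
  rw [profileMass, sum_cyclicProfile k hl₀.ne', geom_sum_eq hl.2.ne]
  field_simp
  ring

lemma profileMass_strictMono (hl : l ∈ Ioo (2 / 5) 1) : StrictMono (profileMass · l) := by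
  intro k m hkm
  have hl₀ : 0 < l := by linarith [hl.1]
  have hG := heckeG_zero_rootParam_pos (Ioo_subset_Ioc_self hl)
  have h1 : 0 < (1 + l) / (1 - l) := div_pos (by linarith) (by linarith [hl.2])
  have := pow_lt_pow_right_of_lt_one₀ hl₀ hl.2 hkm
  simp only [profileMass_eq _ hl]
  gcongr

lemma tendsto_profileMass (hl : l ∈ Ioo (2 / 5) 1) : Tendsto (profileMass · l) atTop
    (𝓝 (heckeG 0 (rootParam l) * ((1 + l) / (1 - l)))) := by
  have hpow := tendsto_pow_atTop_nhds_zero_of_lt_one (by linarith [hl.1] : 0 ≤ l) hl.2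
  simp only [profileMass_eq _ hl]
  have := ((tendsto_const_nhds (x := (2 : ℝ))).div (hpow.const_add 1) (by norm_num)).sub_const 1
  simpa only [add_zero, div_one, show (2 : ℝ) - 1 = 1 by norm_num, mul_one, Pi.div_apply] using
    this.const_mul (heckeG 0 (rootParam l) * ((1 + l) / (1 - l)))

lemma profileMass_half_lt_one (k : ℕ) : profileMass k (1 / 2) < 1 := by
  have hlim : heckeG 0 (rootParam (1 / 2)) * ((1 + 1 / 2) / (1 - 1 / 2)) = 1 := by
    rw [rootParam_half]; norm_num [heckeG]
  have h := tendsto_profileMass (l := 1 / 2) (by norm_num)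
  rw [hlim] at h
  have hmono := profileMass_strictMono (l := 1 / 2) (by norm_num)
  exact (hmono k.lt_succ_self).trans_le (hmono.monotone.ge_of_tendsto h _)

lemma one_lt_profileMass_one (hk : 3 ≤ k) : 1 < profileMass k 1 := by
  have : (3 : ℝ) ≤ k := by exact_mod_cast hk
  rw [profileMass, rootParam_one, sum_cyclicProfile k one_ne_zero]
  norm_num [heckeG]
  linarith

lemma exists_profileMass_eq_one (hk : 3 ≤ k) : ∃ l ∈ Ioo (1 / 2) 1, profileMass k l = 1 :=
  intermediate_value_Ioo (by norm_num) (continuousOn_profileMass k)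
    ⟨profileMass_half_lt_one k, one_lt_profileMass_one hk⟩

lemma eventually_one_lt_profileMass (hl : l ∈ Ioo (1 / 2) 1) :
    ∀ᶠ k in atTop, 1 < profileMass k l := by
  have hl' : l ∈ Ioo (2 / 5) 1 := ⟨by linarith [hl.1], hl.2⟩
  have hy := rootParam_strictMonoOn (by norm_num) (Ioo_subset_Ioc_self hl') hl.1
  rw [rootParam_half] at hy
  refine (tendsto_profileMass hl').eventually_const_lt ?_
  have h1 : 0 < 1 - l := by linarith [hl.2]
  rw [mul_div_assoc', lt_div_iff₀ h1, heckeG]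
  nlinarith [hl.1]

lemma strictAntiOn_of_profileMass_eq_one {l : ℕ → ℝ} (hl : ∀ k ≥ 3, l k ∈ Ioo (1 / 2) 1)
    (hmass : ∀ k ≥ 3, profileMass k (l k) = 1) : StrictAntiOn l (Ici 3) := by
  intro k (hk : 3 ≤ k) m (hm : 3 ≤ m) hkm
  have mem_Ioo {k} (hk : k ≥ 3) : l k ∈ Ioo (2 / 5) 1 := ⟨by linarith [(hl k hk).1], (hl k hk).2⟩
  rw [← (profileMass_strictMonoOn (by omega : 0 < m)).lt_iff_lt
    (Ioo_subset_Ioc_self (mem_Ioo hm)) (Ioo_subset_Ioc_self (mem_Ioo hk)), hmass m hm, ← hmass k hk]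
  exact profileMass_strictMono (mem_Ioo hk) hkm

lemma tendsto_of_profileMass_eq_one {l : ℕ → ℝ} (hl : ∀ k ≥ 3, l k ∈ Ioo (1 / 2) 1)
    (hmass : ∀ k ≥ 3, profileMass k (l k) = 1) : Tendsto l atTop (𝓝 (1 / 2)) := by
  refine tendsto_order.2 ⟨fun a ha => ?_, fun a ha => ?_⟩
  · filter_upwards [eventually_ge_atTop 3] with k hk using ha.trans (hl k hk).1
  · obtain ⟨b, hb, hba⟩ := exists_between (lt_min ha (show (1 / 2 : ℝ) < 1 by norm_num))
    have hb' : b ∈ Ioo (1 / 2) 1 := ⟨hb, hba.trans_le (min_le_right _ _)⟩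
    filter_upwards [eventually_ge_atTop 3, eventually_one_lt_profileMass hb'] with k hk hmass_b
    refine lt_trans ?_ (hba.trans_le (min_le_left _ _))
    rw [← hmass k hk] at hmass_b
    exact ((profileMass_strictMonoOn (by omega)).lt_iff_lt
      ⟨by linarith [(hl k hk).1], (hl k hk).2.le⟩ ⟨by linarith, hb'.2.le⟩).1 hmass_b

theorem exists_heckeG_eq_self :
    ∃ y : ℕ → ℝ, (∀ k, 3 ≤ k → y k ∈ Ioo (0 : ℝ) (1 / 2) ∧ heckeG (k - 1) (y k) = y k ∧
        ∀ x ∈ Ioo (0 : ℝ) (1 / 2), heckeG (k - 1) x = x → x = y k) ∧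
      StrictAntiOn y (Ici 3) ∧ Tendsto y atTop (𝓝 (1 / 6)) := by
  choose! l hl hmass using fun (k : ℕ) (hk : 3 ≤ k) => exists_profileMass_eq_one hk
  have mem_Ioo {k} (hk : k ≥ 3) : l k ∈ Ioo (2 / 5) 1 := ⟨by linarith [(hl k hk).1], (hl k hk).2⟩
  refine ⟨fun k => rootParam (l k), fun k hk => ⟨rootParam_mem_Ioo (hl k hk),
    (heckeG_eq_self_iff hk (mem_Ioo hk)).2 (hmass k hk), fun x hx hGx => ?_⟩, ?_, ?_⟩
  · obtain ⟨u, hu, rfl⟩ := exists_rootParam_eq hx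
    congr 1
    refine (profileMass_strictMonoOn (by omega : 0 < k)).injOn (Ioo_subset_Ioc_self hu)
      (Ioo_subset_Ioc_self (mem_Ioo hk)) ?_
    rw [hmass k hk, (heckeG_eq_self_iff hk hu).1 hGx]
  · intro k hk m hm hkm
    exact rootParam_strictMonoOn (Ioo_subset_Ioc_self (mem_Ioo hm))
      (Ioo_subset_Ioc_self (mem_Ioo hk)) (strictAntiOn_of_profileMass_eq_one hl hmass hk hm hkm)
  · rw [← rootParam_half]
    exact (continuousOn_rootParam.continuousAt (Icc_mem_nhds (by norm_num) (by norm_num))).tendsto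
      |>.comp (tendsto_of_profileMass_eq_one hl hmass)

variable (hk : 3 ≤ k) (hy : y ∈ Ioo 0 (1 / 2)) (hG : heckeG (k - 1) y = y)
include hk hy hG

lemma heckeG_pos (n : ℕ) : 0 < heckeG n y := by
  obtain ⟨l, hl, rfl⟩ := exists_rootParam_eq hy
  have hl' := Ioo_subset_Ioc_self hl
  rw [heckeG_rootParam_eq_mul_cyclicProfile hk hl' hG]
  exact mul_pos (heckeG_zero_rootParam_pos hl') (cyclicProfile_pos (by linarith [hl.1]))

lemma heckeG_self : heckeG k y = heckeG 0 y := by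
  obtain ⟨l, hl, rfl⟩ := exists_rootParam_eq hy
  have hl₀ : 0 < l := by linarith [hl.1]
  rw [heckeG_rootParam_eq_mul_cyclicProfile hk (Ioo_subset_Ioc_self hl) hG,
    ← cyclicProfile_sub hl₀.ne' le_rfl, Nat.sub_self, cyclicProfile_zero hl₀, mul_one]

lemma heckeG_lt_heckeG_zero (hn : n ∈ Ioo 0 k) : heckeG n y < heckeG 0 y := by
  obtain ⟨l, hl, rfl⟩ := exists_rootParam_eq hy
  have hl' := Ioo_subset_Ioc_self hl
  rw [heckeG_rootParam_eq_mul_cyclicProfile hk hl' hG]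
  exact mul_lt_of_lt_one_right (heckeG_zero_rootParam_pos hl')
    (cyclicProfile_lt_one ⟨by linarith [hl.1], hl.2⟩ hn)

lemma sum_heckeG : ∑ n ∈ Finset.range k, heckeG n y = 1 := by
  obtain ⟨l, hl, rfl⟩ := exists_rootParam_eq hy
  rw [Finset.sum_congr rfl fun n _ =>
      heckeG_rootParam_eq_mul_cyclicProfile hk (Ioo_subset_Ioc_self hl) hG n, ← Finset.mul_sum]
  exact (heckeG_eq_self_iff hk hl).1 hG

end RootParam

/-! ### Normal forms in free products -/

section NormalForm

variable {ι : Type} [DecidableEq ι] {G : ι → Type} [∀ i, Group (G i)] [∀ i, DecidableEq (G i)]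

/-- The factor of the first letter of the normal form, `none` at the identity. As inversion
reverses normal forms, `headFactor g⁻¹` is the factor of the last letter of `g`. -/
def headFactor (g : CoprodI G) : Option ι := (CoprodI.Word.equiv g).fstIdx

variable {i : ι} {x : G i} {g h : CoprodI G}

lemma equiv_of_mul (hx : x ≠ 1) (hg : (CoprodI.Word.equiv g).fstIdx ≠ some i) :
    CoprodI.Word.equiv (CoprodI.of x * g) = .cons x (CoprodI.Word.equiv g) hg hx := by
  rw [← Equiv.eq_symm_apply]
  exact (congrArg (CoprodI.of x * ·) (CoprodI.Word.equiv.symm_apply_apply g)).symm.trans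
    (CoprodI.Word.prod_cons i x _ hx hg).symm

lemma equiv_one : CoprodI.Word.equiv (1 : CoprodI G) = .empty :=
  one_smul (CoprodI G) _

@[simp]
lemma normalForm_one : normalForm (1 : CoprodI G) = [] :=
  congrArg CoprodI.Word.toList equiv_one

@[simp]
lemma headFactor_one : headFactor (1 : CoprodI G) = none :=
  congrArg CoprodI.Word.fstIdx equiv_one

lemma normalForm_of_mul (hx : x ≠ 1) (hg : headFactor g ≠ some i) :
    normalForm (CoprodI.of x * g) = ⟨i, x⟩ :: normalForm g := by
  rw [normalForm, equiv_of_mul hx hg]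
  rfl

lemma headFactor_of_mul (hx : x ≠ 1) (hg : headFactor g ≠ some i) :
    headFactor (CoprodI.of x * g) = some i := by
  rw [headFactor, equiv_of_mul hx hg]
  rfl

lemma headFactor_eq_head? (g : CoprodI G) :
    headFactor g = (normalForm g).head?.map Sigma.fst := rfl

lemma normalForm_injective : Function.Injective (normalForm (G := G)) :=
  fun _ _ h => CoprodI.Word.equiv.injective (CoprodI.Word.ext h)

@[simp]
lemma normalForm_eq_nil : normalForm g = [] ↔ g = 1 := by
  rw [← normalForm_one, normalForm_injective.eq_iff]

lemma headFactor_of (hx : x ≠ 1) : headFactor (CoprodI.of x) = some i := by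
  simpa only [mul_one] using headFactor_of_mul hx (g := 1) (by simp)

lemma headFactor_of_inv (hx : x ≠ 1) : headFactor (CoprodI.of x)⁻¹ = some i := by
  rw [← map_inv, headFactor_of (inv_ne_one.2 hx)]

@[elab_as_elim]
lemma normalForm_induction {P : CoprodI G → Prop} (one : P 1)
    (of_mul : ∀ (i : ι) (x : G i) (g : CoprodI G), x ≠ 1 → headFactor g ≠ some i → P g →
      P (CoprodI.of x * g)) (g : CoprodI G) : P g := by
  obtain ⟨w, rfl⟩ := CoprodI.Word.equiv.symm.surjective g
  induction w using CoprodI.Word.consRecOn with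
  | empty => exact one
  | cons i x w hw hx ih =>
    rw [show CoprodI.Word.equiv.symm (.cons x w hw hx) =
      CoprodI.of x * CoprodI.Word.equiv.symm w from CoprodI.Word.prod_cons i x w hx hw]
    exact of_mul i x _ hx (by rwa [headFactor, Equiv.apply_symm_apply]) ih

lemma exists_eq_of_mul (i : ι) (g : CoprodI G) :
    ∃ (x : G i) (h : CoprodI G), headFactor h ≠ some i ∧ g = CoprodI.of x * h := by
  induction g using normalForm_induction with
  | one => exact ⟨1, 1, by simp, by simp⟩
  | of_mul j y g hy hg _ =>
    rcases eq_or_ne j i with rfl | hji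
    · exact ⟨y, g, hg, rfl⟩
    · refine ⟨1, _, ?_, by rw [map_one, one_mul]⟩
      rwa [headFactor_of_mul hy hg, Ne, Option.some.injEq]

lemma headFactor_of_mul_ne_iff (hg : headFactor g ≠ some i) :
    headFactor (CoprodI.of x * g) ≠ some i ↔ x = 1 := by
  refine ⟨fun h => by_contra fun hx => h (headFactor_of_mul hx hg), ?_⟩
  rintro rfl
  rwa [map_one, one_mul]

lemma headFactor_mul_of (hg : g ≠ 1) (x : G i) :
    headFactor (g * CoprodI.of x) = headFactor g ∨ g * CoprodI.of x = 1 := by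
  induction g using normalForm_induction with
  | one => exact absurd rfl hg
  | of_mul j y g hy hgj ih =>
    rw [headFactor_of_mul hy hgj, mul_assoc]
    by_cases hg1 : g = 1
    · subst hg1
      rw [one_mul]
      rcases eq_or_ne j i with rfl | hji
      · rw [← map_mul]
        by_cases hyx : y * x = 1
        · exact .inr (by rw [hyx, map_one])
        · exact .inl (headFactor_of hyx)
      · refine .inl (headFactor_of_mul hy ?_)
        by_cases hx : x = 1
        · simp [hx]
        · simpa [headFactor_of hx] using hji.symm
    · refine .inl (headFactor_of_mul hy ?_)
      rcases ih hg1 with h | h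
      · rwa [h]
      · simp [h]

lemma headFactor_mul_of_ne {j : ι} (hg : g ≠ 1) (hgj : headFactor g ≠ some j) (x : G i) :
    headFactor (g * CoprodI.of x) ≠ some j := by
  rcases headFactor_mul_of hg x with h | h
  · rwa [h]
  · simp [h]

lemma normalForm_dropLast_prefix (g : CoprodI G) (x : G i) :
    (normalForm g).dropLast <+: normalForm (g * CoprodI.of x) := by
  induction g using normalForm_induction with
  | one => simp
  | of_mul j y g hy hgj ih =>
    rw [normalForm_of_mul hy hgj]
    by_cases hg1 : g = 1
    · simp [hg1]
    · rw [List.dropLast_cons_of_ne_nil (by simpa using hg1), mul_assoc,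
        normalForm_of_mul hy (headFactor_mul_of_ne hg1 hgj x), List.prefix_cons_inj]
      exact ih

lemma headFactor_inv_of_mul (hx : x ≠ 1) (hg : headFactor g ≠ some i) (hg1 : g ≠ 1) :
    headFactor (CoprodI.of x * g)⁻¹ = headFactor g⁻¹ := by
  rw [mul_inv_rev, ← map_inv]
  refine (headFactor_mul_of (inv_ne_one.2 hg1) x⁻¹).resolve_right fun h => hg ?_
  rw [inv_mul_eq_one.1 h, headFactor_of (inv_ne_one.2 hx)]

lemma normalForm_mul_of (hx : x ≠ 1) (hg : headFactor g⁻¹ ≠ some i) :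
    normalForm (g * CoprodI.of x) = normalForm g ++ [⟨i, x⟩] := by
  induction g using normalForm_induction with
  | one => simpa using normalForm_of_mul hx (g := 1) (by simp)
  | of_mul j y g hy hgj ih =>
    rw [normalForm_of_mul hy hgj, mul_assoc, List.cons_append]
    by_cases hg1 : g = 1
    · subst hg1
      rw [mul_one, headFactor_of_inv hy] at hg
      rw [one_mul, normalForm_of_mul hy (by rw [headFactor_of hx]; exact hg.symm), normalForm_one,
        List.nil_append, ← mul_one (CoprodI.of x), normalForm_of_mul hx (by simp), normalForm_one]
    · rw [headFactor_inv_of_mul hy hgj hg1] at hg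
      rw [normalForm_of_mul hy (headFactor_mul_of_ne hg1 hgj x), ih hg]

lemma cons_prefix_normalForm_of_mul_iff {y : G i} {l : List (Σ i, G i)} (hx : x ≠ 1)
    (hh : headFactor h ≠ some i) :
    ⟨i, x⟩ :: l <+: normalForm (CoprodI.of y * h) ↔ y = x ∧ l <+: normalForm h := by
  by_cases hy : y = 1
  · subst hy
    refine iff_of_false (fun hl => hh ?_) fun hl => hx hl.1.symm
    obtain ⟨t, ht⟩ := hl
    rw [headFactor_eq_head?, ← one_mul h, ← map_one (CoprodI.of (i := i)), ← ht]
    rfl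
  · rw [normalForm_of_mul hy hh, List.cons_prefix_cons, Sigma.mk.injEq, heq_eq_eq,
      eq_comm (a := y)]
    simp only [true_and]

/-- Both sides say that no letter of `w` is cancelled or modified in the product `w⁻¹ * g`. -/
lemma normalForm_prefix_iff {w : CoprodI G} (hw : w ≠ 1) (g : CoprodI G) :
    normalForm w <+: normalForm g ↔ headFactor (w⁻¹ * g) ≠ headFactor w⁻¹ := by
  induction w using normalForm_induction generalizing g with
  | one => exact absurd rfl hw
  | of_mul i x w hx hwi ih =>
    obtain ⟨y, h, hh, rfl⟩ := exists_eq_of_mul i g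
    rw [normalForm_of_mul hx hwi, cons_prefix_normalForm_of_mul_iff hx hh]
    by_cases hw1 : w = 1
    · subst hw1
      rw [mul_one, headFactor_of_inv hx, ← map_inv, ← mul_assoc, ← map_mul,
        headFactor_of_mul_ne_iff hh, inv_mul_eq_one, eq_comm]
      simp
    · rw [headFactor_inv_of_mul hx hwi hw1, mul_inv_rev, mul_assoc, ← map_inv, ← mul_assoc _ _ h,
        ← map_mul, ← ih hw1]
      by_cases hyx : y = x
      · simp [hyx]
      · refine iff_of_false (fun hp => hyx hp.1) fun hp => hwi ?_
        rw [normalForm_of_mul (by rwa [Ne, inv_mul_eq_one, eq_comm]) hh] at hp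
        obtain hnil | ⟨t, ht, -⟩ := List.prefix_cons_iff.1 hp
        · exact absurd (normalForm_eq_nil.1 hnil) hw1
        · rw [headFactor_eq_head?, ht]
          rfl

section WordLength

@[simp]
lemma wordLength_one : wordLength (1 : CoprodI G) = 0 := by simp [wordLength]

lemma wordLength_of_mul (hx : x ≠ 1) (hg : headFactor g ≠ some i) :
    wordLength (CoprodI.of x * g) = wordLength g + 1 := by
  rw [wordLength, normalForm_of_mul hx hg, List.length_cons, wordLength]

lemma wordLength_of_mul_le (x : G i) (g : CoprodI G) :
    wordLength (CoprodI.of x * g) ≤ wordLength g + 1 := by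
  have length_le {y : G i} {h : CoprodI G} (hh : headFactor h ≠ some i) :
      wordLength h ≤ wordLength (CoprodI.of y * h) ∧
        wordLength (CoprodI.of y * h) ≤ wordLength h + 1 := by
    by_cases hy : y = 1
    · simp [hy]
    · simp [wordLength_of_mul hy hh]
  obtain ⟨y, h, hh, rfl⟩ := exists_eq_of_mul i g
  rw [← mul_assoc, ← map_mul]
  exact (length_le hh).2.trans (Nat.add_le_add_right (length_le hh).1 1)

lemma wordLength_mul_le (g h : CoprodI G) :
    wordLength (g * h) ≤ wordLength g + wordLength h := by
  induction g using normalForm_induction with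
  | one => simp
  | of_mul i x g hx hg ih =>
    rw [wordLength_of_mul hx hg, mul_assoc]
    have := wordLength_of_mul_le x (g * h)
    omega

lemma wordLength_of_le_one (x : G i) : wordLength (CoprodI.of x) ≤ 1 := by
  simpa using wordLength_of_mul_le x 1

@[simp]
lemma wordLength_inv (g : CoprodI G) : wordLength g⁻¹ = wordLength g := by
  have length_inv_le (g : CoprodI G) : wordLength g⁻¹ ≤ wordLength g := by
    induction g using normalForm_induction with
    | one => simp
    | of_mul i x g hx hg ih =>
      rw [wordLength_of_mul hx hg, mul_inv_rev, ← map_inv]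
      have := wordLength_mul_le g⁻¹ (CoprodI.of x⁻¹)
      have := wordLength_of_le_one x⁻¹
      omega
  exact (length_inv_le g).antisymm (by simpa using length_inv_le g⁻¹)

end WordLength

section InfiniteWord

/-- The element of the free product represented by the word of length one. -/
def Letter.toGroup (u : Letter G) : CoprodI G := CoprodI.of u.1.2

variable {u ξ : ℕ → Letter G} {n : ℕ} {X : ℕ → CoprodI G}

lemma headFactor_inv_mul_toGroup {v : Letter G} (hg : headFactor g⁻¹ ≠ some v.factor) :
    headFactor (g * v.toGroup)⁻¹ = some v.factor := by
  rw [mul_inv_rev, Letter.toGroup, ← map_inv]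
  exact headFactor_of_mul (inv_ne_one.2 v.2) hg

lemma headFactor_walk_toGroup_inv (hu : ∀ j < n, (u j).factor ≠ (u (j + 1)).factor) :
    headFactor (walk (fun j => (u j).toGroup) (n + 1))⁻¹ = some (u n).factor := by
  induction n with
  | zero => exact headFactor_inv_mul_toGroup (by simp [walk])
  | succ n ih =>
    refine headFactor_inv_mul_toGroup ?_
    rw [ih fun j hj => hu j (by omega), Ne, Option.some_inj]
    exact hu n (by omega)

lemma normalForm_walk_toGroup (hu : ∀ j < n, (u j).factor ≠ (u (j + 1)).factor) :
    normalForm (walk (fun j => (u j).toGroup) (n + 1)) =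
      (List.range (n + 1)).map fun j => (u j).1 := by
  induction n with
  | zero => exact normalForm_mul_of (u 0).2 (by simp [walk])
  | succ n ih =>
    rw [walk, Letter.toGroup, normalForm_mul_of (u (n + 1)).2 ?_, ih fun j hj => hu j (by omega),
      List.range_succ (n := n + 1), List.map_append, List.map_singleton]
    rw [headFactor_walk_toGroup_inv fun j hj => hu j (by omega), Ne, Option.some_inj]
    exact hu n (by omega)

lemma exists_tendsToInfiniteWord {ω : ℕ → CoprodI G}
    (hω : ∀ n, ω n ∈ Set.range Letter.toGroup)
    (hlen : Tendsto (fun n => wordLength (walk ω n)) atTop atTop) :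
    ∃ ξ, TendsToInfiniteWord (walk ω) ξ := by
  choose v hv using hω
  suffices ∀ m, ∃ u : Letter G, ∀ᶠ n in atTop, (normalForm (walk ω n))[m]? = some u.1 from
    Classical.skolem.1 this
  intro m
  obtain ⟨n₀, hn₀⟩ := eventually_atTop.1 (hlen.eventually_ge_atTop (m + 2))
  have hlt : m < (normalForm (walk ω n₀)).length := lt_of_lt_of_le (by omega) (hn₀ n₀ le_rfl)
  refine ⟨⟨(normalForm (walk ω n₀))[m], CoprodI.Word.ne_one _ _ (List.getElem_mem hlt)⟩,
    eventually_atTop.2 ⟨n₀, fun n hn => ?_⟩⟩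
  induction n, hn using Nat.le_induction with
  | base => exact List.getElem?_eq_getElem hlt
  | succ n hn ih =>
    have hm : m < (normalForm (walk ω n)).dropLast.length := by
      have : m + 2 ≤ (normalForm (walk ω n)).length := hn₀ n hn
      rw [List.length_dropLast]
      omega
    obtain ⟨t, ht⟩ := normalForm_dropLast_prefix (walk ω n) (v n).1.2
    rw [← ih, walk, ← hv n, Letter.toGroup, ← ht, List.getElem?_append_left hm,
      List.getElem?_dropLast, if_pos]
    rwa [List.length_dropLast] at hm

namespace TendsToInfiniteWord

lemma factor_ne (h : TendsToInfiniteWord X ξ) (m : ℕ) :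
    (ξ m).factor ≠ (ξ (m + 1)).factor := by
  obtain ⟨n, h₀, h₁⟩ := ((h m).and (h (m + 1))).exists
  obtain ⟨_, e₀⟩ := List.getElem?_eq_some_iff.1 h₀
  obtain ⟨hlt, e₁⟩ := List.getElem?_eq_some_iff.1 h₁
  have hchain : (normalForm (X n)).IsChain fun a b => a.1 ≠ b.1 := CoprodI.Word.chain_ne _
  have := List.isChain_iff_getElem.1 hchain m hlt
  rwa [e₀, e₁] at this

lemma eventually_prefix_iff (h : TendsToInfiniteWord X ξ) (l : List (Σ i, G i)) :
    ∀ᶠ k in atTop, l <+: normalForm (X k) ↔ ∀ m (hm : m < l.length), (ξ m).1 = l[m] := by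
  have : ∀ᶠ k in atTop, ∀ m < l.length, (normalForm (X k))[m]? = some (ξ m).1 :=
    (Filter.eventually_all_finite (Set.finite_lt_nat l.length)).2 fun m _ => h m
  filter_upwards [this] with k hk
  rw [List.prefix_iff_getElem?]
  exact forall₂_congr fun m hm => by rw [hk m hm, Option.some_inj]

end TendsToInfiniteWord

end InfiniteWord

end NormalForm

/-! ### Random walks on free products -/

section Subgaussian

variable {Ω : Type*} [MeasurableSpace Ω] {P : Measure Ω}

lemma hasSubgaussianMGF_iff_lintegral_le {X : Ω → ℝ} {c : ℝ≥0} (hX : AEMeasurable X P) :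
    HasSubgaussianMGF X c P ↔
      ∀ t : ℝ, ∫⁻ ω, .ofReal (Real.exp (t * X ω)) ∂P ≤ .ofReal (Real.exp (c * t ^ 2 / 2)) := by
  have pos (t : ℝ) : 0 ≤ᵐ[P] fun ω => Real.exp (t * X ω) := ae_of_all _ fun ω => (Real.exp_pos _).le
  have meas (t : ℝ) : AEStronglyMeasurable (fun ω => Real.exp (t * X ω)) P :=
    (hX.const_mul t).exp.aestronglyMeasurable
  refine ⟨fun h t => ?_, fun h => ⟨fun t => ?_, fun t => ?_⟩⟩
  · rw [← ofReal_integral_eq_lintegral_ofReal (h.integrable_exp_mul t) (pos t)]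
    exact ENNReal.ofReal_le_ofReal (h.mgf_le t)
  · refine ⟨meas t, (hasFiniteIntegral_iff_ofReal (pos t)).2 ?_⟩
    exact (h t).trans_lt ENNReal.ofReal_lt_top
  · rw [mgf, integral_eq_lintegral_of_nonneg_ae (pos t) (meas t)]
    exact ENNReal.toReal_le_of_le_ofReal (Real.exp_pos _).le (h t)

lemma hasSubgaussianMGF_mconv {M : Type*} [Monoid M] [MeasurableSpace M] [MeasurableMul₂ M]
    {ρ μ : Measure M} [SFinite μ] {f h : M → ℝ} {c c' : ℝ≥0} (hf : HasSubgaussianMGF f c ρ)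
    (hm : Measurable h) (hd : ∀ x, HasSubgaussianMGF (fun y => h (x * y) - f x) c' μ) :
    HasSubgaussianMGF h (c + c') (ρ ∗ₘ μ) := by
  refine (hasSubgaussianMGF_iff_lintegral_le hm.aemeasurable).2 fun t => ?_
  have hstep (x : M) : ∫⁻ y, .ofReal (Real.exp (t * h (x * y))) ∂μ ≤
      .ofReal (Real.exp (t * f x)) * .ofReal (Real.exp (c' * t ^ 2 / 2)) := by
    have key (y : M) : ENNReal.ofReal (Real.exp (t * h (x * y))) =
        .ofReal (Real.exp (t * f x)) * .ofReal (Real.exp (t * (h (x * y) - f x))) := by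
      rw [← ENNReal.ofReal_mul (Real.exp_pos _).le, ← Real.exp_add]
      ring_nf
    simp_rw [key]
    rw [lintegral_const_mul' _ _ ENNReal.ofReal_ne_top]
    gcongr
    exact (hasSubgaussianMGF_iff_lintegral_le (hd x).aemeasurable).1 (hd x) t
  calc ∫⁻ z, .ofReal (Real.exp (t * h z)) ∂(ρ ∗ₘ μ)
    _ = ∫⁻ x, ∫⁻ y, .ofReal (Real.exp (t * h (x * y))) ∂μ ∂ρ :=
      Measure.lintegral_mconv (by fun_prop)
    _ ≤ ∫⁻ x, .ofReal (Real.exp (t * f x)) * .ofReal (Real.exp (c' * t ^ 2 / 2)) ∂ρ :=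
      lintegral_mono hstep
    _ ≤ .ofReal (Real.exp (c * t ^ 2 / 2)) * .ofReal (Real.exp (c' * t ^ 2 / 2)) := by
      rw [lintegral_mul_const' _ _ ENNReal.ofReal_ne_top]
      gcongr
      exact (hasSubgaussianMGF_iff_lintegral_le hf.aemeasurable).1 hf t
    _ = .ofReal (Real.exp ((c + c' : ℝ≥0) * t ^ 2 / 2)) := by
      rw [← ENNReal.ofReal_mul (Real.exp_pos _).le, ← Real.exp_add]
      push_cast
      ring_nf

lemma ae_eventually_lt_of_hasSubgaussianMGF [IsFiniteMeasure P] {M : ℕ → Ω → ℝ} {c : ℝ≥0}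
    (hc : c ≠ 0) (hM : ∀ n, HasSubgaussianMGF (M n) (n * c) P) {ε : ℝ} (hε : 0 < ε) :
    ∀ᵐ ω ∂P, ∀ᶠ n : ℕ in atTop, M n ω < n * ε := by
  have bound (n : ℕ) :
      P {ω | n * ε ≤ M n ω} ≤ .ofReal (Real.exp (-(ε ^ 2 / (2 * c))) ^ n) := by
    rw [← ofReal_measureReal, ← Real.exp_nat_mul]
    refine ENNReal.ofReal_le_ofReal (((hM n).measure_ge_le (by positivity)).trans_eq ?_)
    rcases eq_or_ne n 0 with rfl | hn
    · simp
    · push_cast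
      congr 1
      field_simp
  have summable : Summable fun n : ℕ => Real.exp (-(ε ^ 2 / (2 * c))) ^ n := by
    refine summable_geometric_of_lt_one (Real.exp_pos _).le (Real.exp_lt_one_iff.2 ?_)
    have : (0 : ℝ) < c := by positivity
    exact neg_lt_zero.2 (by positivity)
  filter_upwards [ae_eventually_notMem
    (ne_top_of_le_ne_top summable.tsum_ofReal_ne_top (ENNReal.tsum_le_tsum bound))] with ω hω
  exact hω.mono fun n hn => not_le.1 hn

lemma ae_tendsto_div_of_hasSubgaussianMGF [IsFiniteMeasure P] {M : ℕ → Ω → ℝ} {c : ℝ≥0}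
    (hc : c ≠ 0) (hM : ∀ n, HasSubgaussianMGF (M n) (n * c) P) :
    ∀ᵐ ω ∂P, Tendsto (fun n : ℕ => M n ω / n) atTop (𝓝 0) := by
  obtain ⟨ε, -, hε, hε0⟩ := exists_seq_strictAnti_tendsto (0 : ℝ)
  have upper := ae_all_iff.2 fun m => ae_eventually_lt_of_hasSubgaussianMGF hc hM (hε m)
  have lower := ae_all_iff.2 fun m =>
    ae_eventually_lt_of_hasSubgaussianMGF hc (fun n => (hM n).neg) (hε m)
  filter_upwards [upper, lower] with ω hu hl
  refine Metric.tendsto_nhds.2 fun δ hδ => ?_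
  obtain ⟨m, hm⟩ := (hε0.eventually_lt_const hδ).exists
  filter_upwards [hu m, hl m, eventually_gt_atTop 0] with n hun hln hn
  have hn' : (0 : ℝ) < n := by exact_mod_cast hn
  rw [Real.dist_eq, sub_zero, abs_div, Nat.abs_cast, div_lt_iff₀ hn']
  refine (abs_lt.2 ⟨?_, hun⟩).trans ((mul_comm (n : ℝ) (ε m)).trans_lt (by gcongr))
  rw [Pi.neg_apply] at hln
  linarith

end Subgaussian

section Increments

variable {ι : Type} {G : ι → Type} [∀ i, Group (G i)]

lemma walk_congr {ω ω' : ℕ → CoprodI G} {n : ℕ} (h : ∀ j < n, ω j = ω' j) :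
    walk ω n = walk ω' n := by
  induction n with
  | zero => rfl
  | succ n ih => rw [walk, walk, ih fun j hj => h j (by omega), h n (by omega)]

variable (μ : Measure (CoprodI G)) [IsProbabilityMeasure μ]

instance incrementLaw_isProbabilityMeasure : IsProbabilityMeasure (incrementLaw μ) := by
  unfold incrementLaw
  infer_instance

lemma incrementLaw_map_eval (n : ℕ) : (incrementLaw μ).map (fun ω => ω n) = μ :=
  Measure.infinitePi_map_eval (fun _ : ℕ => μ) n

variable {μ} in
lemma ae_increment {p : CoprodI G → Prop} (hp : ∀ᵐ s ∂μ, p s) :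
    ∀ᵐ ω ∂(incrementLaw μ), ∀ n, p (ω n) :=
  ae_all_iff.2 fun n => by
    rw [← incrementLaw_map_eval μ n] at hp
    exact ae_of_ae_map (measurable_pi_apply n).aemeasurable hp

end Increments

section Walk

variable {ι : Type} {G : ι → Type} [∀ i, Group (G i)]

instance instDiscreteMeasurableSpaceCoprodI : DiscreteMeasurableSpace (CoprodI G) :=
  ⟨fun _ => trivial⟩

instance instDiscreteMeasurableSpaceLetter : DiscreteMeasurableSpace (Letter G) :=
  ⟨fun _ => trivial⟩

variable [Countable ι] [∀ i, Countable (G i)]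

instance instCountableCoprodI : Countable (CoprodI G) := by
  classical exact normalForm_injective.countable

instance instCountableLetter : Countable (Letter G) :=
  inferInstanceAs (Countable {x : Σ i, G i // x.2 ≠ 1})

@[fun_prop]
lemma measurable_walk (n : ℕ) : Measurable fun ω : ℕ → CoprodI G => walk ω n := by
  induction n with
  | zero => exact measurable_const
  | succ n ih => exact ih.mul (measurable_pi_apply n)

variable (μ : Measure (CoprodI G)) [IsProbabilityMeasure μ]

lemma indepFun_walk (n : ℕ) :
    IndepFun (fun ω : ℕ → CoprodI G => walk ω n) (fun ω => ω n) (incrementLaw μ) := by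
  have indep : iIndepFun (fun (i : ℕ) (ω : ℕ → CoprodI G) => ω i) (incrementLaw μ) :=
    iIndepFun_infinitePi (X := fun _ x => x) fun _ => measurable_id
  let past (v : Finset.range n → CoprodI G) : CoprodI G :=
    walk (fun i => if h : i ∈ Finset.range n then v ⟨i, h⟩ else 1) n
  have past_measurable : Measurable past := by
    refine (measurable_walk n).comp (measurable_pi_lambda _ fun i => ?_)
    split_ifs <;> fun_prop
  have := (indep.indepFun_finset (Finset.range n) {n} (by simp) measurable_pi_apply).comp
    past_measurable (measurable_pi_apply (⟨n, by simp⟩ : ({n} : Finset ℕ)))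
  convert this using 1
  · funext ω
    exact walk_congr fun i hi => by simp [hi]
  · rfl

lemma map_walk_succ (n : ℕ) : (incrementLaw μ).map (fun ω => walk ω (n + 1)) =
    (incrementLaw μ).map (fun ω => walk ω n) ∗ₘ μ := by
  have := (indepFun_walk μ n).map_mul_eq_map_mconv_map (measurable_walk n)
    (measurable_pi_apply n)
  rwa [incrementLaw_map_eval] at this

variable {μ} {γ C : ℝ} {Φ : CoprodI G → ℝ}

lemma hasSubgaussianMGF_walk {a b : ℝ} (hΦ1 : Φ 1 = 0)
    (hΦ : ∀ g, ∫ s, (Φ (g * s) - Φ g) ∂μ = γ)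
    (hab : ∀ g, ∀ᵐ s ∂μ, Φ (g * s) - Φ g ∈ Icc a b) (n : ℕ) :
    HasSubgaussianMGF (fun ω => Φ (walk ω n) - n * γ) (n * (‖b - a‖₊ / 2) ^ 2)
      (incrementLaw μ) := by
  suffices HasSubgaussianMGF (fun g => Φ g - n * γ) (n * (‖b - a‖₊ / 2) ^ 2)
      ((incrementLaw μ).map (walk · n)) from .of_map (measurable_walk n).aemeasurable this
  induction n with
  | zero =>
    simp only [walk, CharP.cast_eq_zero, zero_mul, sub_zero, Measure.map_const, measure_univ,
      one_smul]
    exact HasSubgaussianMGF.fun_zero.congr (by simp [EventuallyEq, ae_dirac_eq, hΦ1])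
  | succ n ih =>
    rw [map_walk_succ, Nat.cast_succ, Nat.cast_succ, add_one_mul, add_one_mul]
    refine hasSubgaussianMGF_mconv ih .of_discrete fun g => ?_
    have := hasSubgaussianMGF_of_mem_Icc (Measurable.of_discrete.aemeasurable) (hab g)
    rw [hΦ g] at this
    convert this using 2
    ring

lemma integral_walk_of_harmonic {H : CoprodI G → ℝ} (hC : ∀ g, |H g| ≤ C)
    (hH : ∀ g, ∫ s, H (g * s) ∂μ = H g) (n : ℕ) :
    ∫ ω, H (walk ω n) ∂(incrementLaw μ) = H 1 := by
  have meas : Measurable H := .of_discrete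
  rw [← integral_map (measurable_walk n).aemeasurable meas.aestronglyMeasurable]
  induction n with
  | zero => simp [walk]
  | succ n ih =>
    have : IsProbabilityMeasure ((incrementLaw μ).map (walk · n)) :=
      Measure.isProbabilityMeasure_map (measurable_walk n).aemeasurable
    rw [map_walk_succ, integral_mconv]
    · simpa only [hH] using ih
    · exact .of_bound meas.aestronglyMeasurable C (ae_of_all _ hC)

lemma measureReal_eq_of_harmonic {H : CoprodI G → ℝ} (hC : ∀ g, |H g| ≤ C)
    (hH : ∀ g, ∫ s, H (g * s) ∂μ = H g) {A : Set (ℕ → CoprodI G)} (hA : MeasurableSet A)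
    (hlim : ∀ᵐ ω ∂(incrementLaw μ),
      Tendsto (fun n => H (walk ω n)) atTop (𝓝 (A.indicator 1 ω))) :
    (incrementLaw μ).real A = H 1 := by
  have meas (n : ℕ) : Measurable fun ω => H (walk ω n) :=
    Measurable.of_discrete.comp (measurable_walk n)
  have key := tendsto_integral_of_dominated_convergence (fun _ => C)
    (fun n => (meas n).aestronglyMeasurable) (integrable_const C)
    (fun n => ae_of_all _ fun ω => hC (walk ω n)) hlim
  simp only [integral_walk_of_harmonic hC hH, integral_indicator_one hA] at key
  exact tendsto_nhds_unique key tendsto_const_nhds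

end Walk

section WordLength

variable {ι : Type} [DecidableEq ι] {G : ι → Type} [∀ i, Group (G i)] [∀ i, DecidableEq (G i)]

lemma abs_wordLength_mul_sub_le (g : CoprodI G) {s : CoprodI G}
    (hs : s ∈ range Letter.toGroup) : |(wordLength (g * s) : ℝ) - wordLength g| ≤ 1 := by
  obtain ⟨v, rfl⟩ := hs
  have h₁ := wordLength_of_le_one v.1.2
  have h₂ := wordLength_mul_le g v.toGroup
  have h₃ := wordLength_mul_le (g * v.toGroup) v.toGroup⁻¹
  rw [mul_inv_cancel_right, wordLength_inv] at h₃
  rw [Letter.toGroup] at h₂ h₃ ⊢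
  rify at h₁ h₂ h₃
  exact abs_sub_le_iff.2 ⟨by linarith, by linarith⟩

lemma wordLength_walk_le {ω : ℕ → CoprodI G} (hω : ∀ n, ω n ∈ range Letter.toGroup) (n : ℕ) :
    (wordLength (walk ω n) : ℝ) ≤ n := by
  induction n with
  | zero => simp [walk]
  | succ n ih =>
    have := (abs_sub_le_iff.1 (abs_wordLength_mul_sub_le (walk ω n) (hω n))).1
    rw [walk, Nat.cast_add_one]
    linarith

lemma ae_exists_tendsToInfiniteWord {μ : Measure (CoprodI G)} [IsProbabilityMeasure μ] {γ : ℝ}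
    (hμ : ∀ᵐ s ∂μ, s ∈ range Letter.toGroup) (hγ : HasDrift μ γ) (hpos : 0 < γ) :
    ∀ᵐ ω ∂(incrementLaw μ), ∃ ξ, TendsToInfiniteWord (walk ω) ξ := by
  filter_upwards [ae_increment hμ, hγ.1] with ω hω hlim
  refine exists_tendsToInfiniteWord hω (tendsto_natCast_atTop_iff (R := ℝ).1 ?_)
  refine (tendsto_natCast_atTop_atTop.atTop_mul_pos hpos hlim).congr' ?_
  filter_upwards [eventually_ne_atTop 0] with n hn
  exact mul_div_cancel₀ _ (Nat.cast_ne_zero.2 hn)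

variable [Countable ι] [∀ i, Countable (G i)] {μ : Measure (CoprodI G)} [IsProbabilityMeasure μ]

lemma exists_measurable_limit [Nonempty (Letter G)]
    (h : ∀ᵐ ω ∂(incrementLaw μ), ∃ ξ, TendsToInfiniteWord (walk ω) ξ) :
    ∃ Xinf : (ℕ → CoprodI G) → ℕ → Letter G, Measurable Xinf ∧
      ∀ᵐ ω ∂(incrementLaw μ), TendsToInfiniteWord (walk ω) (Xinf ω) := by
  let stable (m : ℕ) (u : Letter G) : Set (ℕ → CoprodI G) :=
    {ω | ∀ᶠ n in atTop, (normalForm (walk ω n))[m]? = some u.1}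
  have stable_measurable (m : ℕ) (u : Letter G) : MeasurableSet (stable m u) := by
    have : stable m u = ⋃ N, ⋂ n ≥ N, (walk · n) ⁻¹' {g | (normalForm g)[m]? = some u.1} := by
      ext ω
      simp [stable]
    rw [this]
    exact .iUnion fun _ => .iInter fun n => .iInter fun _ => measurable_walk n .of_discrete
  have letter_eq (m : ℕ) : Pairwise fun u v : Letter G =>
      EqOn (fun _ => u) (fun _ => v) (stable m u ∩ stable m v) := fun u v _ ω hω => by
    obtain ⟨n, hu, hv⟩ := (hω.1.and hω.2).exists
    exact Subtype.ext (Option.some_inj.1 (hu.symm.trans hv))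
  choose f hf hfeq using fun m =>
    exists_measurable_piecewise (stable m) (stable_measurable m) _ (fun _ => measurable_const)
      (letter_eq m)
  refine ⟨fun ω m => f m ω, measurable_pi_lambda _ hf, ?_⟩
  filter_upwards [h] with ω ⟨ξ, hξ⟩ m
  have : f m ω = ξ m := hfeq m (ξ m) (hξ m)
  simpa only [this] using hξ m

variable {γ C : ℝ} {Φ : CoprodI G → ℝ} (hμ : ∀ᵐ s ∂μ, s ∈ range Letter.toGroup)
include hμ

lemma ae_tendsto_wordLength_div (hΦ1 : Φ 1 = 0) (hΦ : ∀ g, ∫ s, (Φ (g * s) - Φ g) ∂μ = γ)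
    (hC : ∀ g, |Φ g - wordLength g| ≤ C) : ∀ᵐ ω ∂(incrementLaw μ),
      Tendsto (fun n : ℕ => (wordLength (walk ω n) : ℝ) / n) atTop (𝓝 γ) := by
  have hC0 : 0 ≤ C := (abs_nonneg _).trans (hC 1)
  have increment_mem (g : CoprodI G) :
      ∀ᵐ s ∂μ, Φ (g * s) - Φ g ∈ Icc (-(2 * C + 1)) (2 * C + 1) := by
    filter_upwards [hμ] with s hs
    have h₁ := abs_le.1 (hC g)
    have h₂ := abs_le.1 (hC (g * s))
    have h₃ := abs_le.1 (abs_wordLength_mul_sub_le g hs)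
    exact ⟨by linarith, by linarith⟩
  have hc : (‖2 * C + 1 - -(2 * C + 1)‖₊ / 2) ^ 2 ≠ 0 := by
    have : 2 * C + 1 - -(2 * C + 1) ≠ 0 := by linarith
    simpa using this
  filter_upwards [ae_tendsto_div_of_hasSubgaussianMGF hc
    (hasSubgaussianMGF_walk hΦ1 hΦ increment_mem)] with ω hω
  have bounded : Tendsto (fun n : ℕ => (Φ (walk ω n) - wordLength (walk ω n)) / n)
      atTop (𝓝 0) :=
    tendsto_bdd_div_atTop_nhds_zero (.of_forall fun n => (abs_le.1 (hC _)).1)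
      (.of_forall fun n => (abs_le.1 (hC _)).2) tendsto_natCast_atTop_atTop
  have := (hω.sub bounded).add_const γ
  rw [sub_zero, zero_add] at this
  refine this.congr' ?_
  filter_upwards [eventually_ne_atTop 0] with n hn
  have : (n : ℝ) ≠ 0 := Nat.cast_ne_zero.2 hn
  field_simp
  ring

lemma hasDrift_of_potential (hΦ1 : Φ 1 = 0) (hΦ : ∀ g, ∫ s, (Φ (g * s) - Φ g) ∂μ = γ)
    (hC : ∀ g, |Φ g - wordLength g| ≤ C) : HasDrift μ γ := by
  have lim := ae_tendsto_wordLength_div hμ hΦ1 hΦ hC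
  refine ⟨lim, ?_⟩
  have key := tendsto_lintegral_of_dominated_convergence (μ := incrementLaw μ)
    (F := fun n ω => .ofReal |(wordLength (walk ω n) : ℝ) / n - γ|) (f := fun _ => 0)
    (fun _ => .ofReal (1 + |γ|)) (fun n => ?_) (fun n => ?_) (by simp) ?_
  · simpa only [lintegral_zero] using key
  · exact (Measurable.of_discrete (f := fun g : CoprodI G =>
      ENNReal.ofReal |(wordLength g : ℝ) / n - γ|)).comp (measurable_walk n)
  · filter_upwards [ae_increment hμ] with ω hω
    refine ENNReal.ofReal_le_ofReal ((abs_sub _ _).trans (add_le_add_left ?_ _))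
    rw [abs_of_nonneg (by positivity)]
    exact div_le_one_of_le₀ (wordLength_walk_le hω n) n.cast_nonneg
  · filter_upwards [lim] with ω hω
    simpa using ENNReal.tendsto_ofReal (hω.sub_const γ).abs

end WordLength

/-! ### Traffic equations -/

section TrafficEquations

variable {ι : Type} {G : ι → Type} [∀ i, Group (G i)] [∀ i, DecidableEq (G i)]
  {r : Letter G → ℝ} {i j : ι} {g t : CoprodI G}

section HittingWeight

/-- The total weight of the letters outside `G i`, which normalizes the rows of `transition r`
indexed by letters of `G i`. -/
def massOutside (r : Letter G → ℝ) (i : ι) : ℝ :=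
  ∑' w : {w : Letter G // w.factor ≠ i}, r w

/-- The weights `r` of the letters from `G i`, extended to the identity of `G i` by the total
weight of all other letters. -/
def factorWeight (r : Letter G → ℝ) (x : G i) : ℝ :=
  if hx : x = 1 then massOutside r i else r ⟨⟨i, x⟩, hx⟩

/-- For a solution `r` of the traffic equations, the probability that the walk ever visits
`x : G i`. -/
def letterHitting (r : Letter G → ℝ) (x : G i) : ℝ := factorWeight r x / massOutside r i

lemma factorWeight_one : factorWeight r (1 : G i) = massOutside r i := dif_pos rfl

lemma factorWeight_letter (u : Letter G) : factorWeight r u.1.2 = r u := dif_neg u.2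

/-- The letters from `G i` are the non-identity elements of `G i`. -/
def letterEquiv (i : ι) : {w : Letter G // w.factor = i} ≃ {x : G i // x ≠ 1} where
  toFun | ⟨⟨⟨_, x⟩, hx⟩, rfl⟩ => ⟨x, hx⟩
  invFun x := ⟨⟨⟨i, x⟩, x.2⟩, rfl⟩
  left_inv := by rintro ⟨⟨⟨_, x⟩, hx⟩, rfl⟩; rfl
  right_inv _ := rfl

lemma hasSum_factorWeight {m : ℝ} (hr : HasSum r m) (i : ι) :
    HasSum (factorWeight r : G i → ℝ) m := by
  have inside : ∑' w : {w : Letter G | w.factor = i}, r w = m - massOutside r i := by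
    rw [← hr.tsum_eq, ← hr.summable.tsum_subtype_add_tsum_subtype_compl {w | w.factor = i}]
    exact (add_sub_cancel_right _ _).symm
  have nontrivial : HasSum (fun x : ({1}ᶜ : Set (G i)) => factorWeight r x.1)
      (m - massOutside r i) := by
    refine (letterEquiv i).hasSum_iff.1 ?_
    rw [← inside]
    refine (hr.summable.subtype {w | w.factor = i}).hasSum.congr_fun ?_
    rintro ⟨⟨⟨_, x⟩, hx⟩, rfl⟩
    exact factorWeight_letter ⟨⟨_, x⟩, hx⟩
  have trivial : HasSum (fun x : ({1} : Set (G i)) => factorWeight r x.1) (massOutside r i) := by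
    rw [← factorWeight_one]
    exact hasSum_unique _
  simpa using HasSum.add_compl (f := factorWeight r) trivial nontrivial

lemma letterHitting_one (hi : massOutside r i ≠ 0) : letterHitting r (1 : G i) = 1 := by
  rw [letterHitting, factorWeight_one, div_self hi]

lemma letterHitting_letter (u : Letter G) :
    letterHitting r u.1.2 = r u / massOutside r u.factor := by
  rw [letterHitting, factorWeight_letter]
  rfl

lemma massOutside_mul_letterHitting (hi : massOutside r i ≠ 0) (x : G i) :
    massOutside r i * letterHitting r x = factorWeight r x :=
  mul_div_cancel₀ _ hi

variable [DecidableEq ι]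

/-- The multiplicative extension of `letterHitting r` along normal forms. For a solution `r` of
the traffic equations, it is the probability that the walk ever visits `g`. -/
def hitting (r : Letter G → ℝ) (g : CoprodI G) : ℝ :=
  ((normalForm g).map fun x => letterHitting r x.2).prod

@[simp]
lemma hitting_one : hitting r (1 : CoprodI G) = 1 := by simp [hitting]

lemma hitting_of_mul (hi : massOutside r i ≠ 0) (x : G i) (ht : headFactor t ≠ some i) :
    hitting r (CoprodI.of x * t) = letterHitting r x * hitting r t := by
  by_cases hx : x = 1
  · rw [hx, map_one, one_mul, letterHitting_one hi, one_mul]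
  · rw [hitting, normalForm_of_mul hx ht, List.map_cons, List.prod_cons, hitting]

lemma hitting_of (hi : massOutside r i ≠ 0) (x : G i) :
    hitting r (CoprodI.of x) = letterHitting r x := by
  simpa using hitting_of_mul hi x (t := 1) (by simp)

lemma hitting_mul_of (hi : massOutside r i ≠ 0) (x : G i) (hg : headFactor g⁻¹ ≠ some i) :
    hitting r (g * CoprodI.of x) = hitting r g * letterHitting r x := by
  by_cases hx : x = 1
  · rw [hx, map_one, mul_one, letterHitting_one hi, mul_one]
  · rw [hitting, normalForm_mul_of hx hg, List.map_append, List.prod_append, hitting]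
    simp

lemma hitting_of_mul_of_mul (hr : ∀ i, massOutside r i ≠ 0) (y : G j) {x : G i} (hx : x ≠ 1)
    (ht : headFactor t ≠ some i) :
    hitting r (CoprodI.of y * (CoprodI.of x * t)) =
      hitting r (CoprodI.of y * CoprodI.of x) * hitting r t := by
  rcases eq_or_ne i j with rfl | hij
  · rw [← mul_assoc, ← map_mul, hitting_of (hr i), hitting_of_mul (hr i) _ ht]
  · have hne {t : CoprodI G} (ht : headFactor t ≠ some i) :
        headFactor (CoprodI.of x * t) ≠ some j := by
      rwa [headFactor_of_mul hx ht, Ne, Option.some_inj]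
    have hx' := hne (t := 1) (by simp)
    rw [mul_one] at hx'
    rw [hitting_of_mul (hr j) y (hne ht), hitting_of_mul (hr i) x ht,
      hitting_of_mul (hr j) y hx', hitting_of (hr i), mul_assoc]

/-- The mean, over infinite words `ξ` with the Markovian multiplicative law attached to `r`, of
twice the number of letters cancelled in `h⁻¹ * ξ`, plus one if two letters merge; the argument is
the normal form of `h`. -/
def meanCancellation (r : Letter G → ℝ) : List (Σ i, G i) → ℝ
  | [] => 0
  | ⟨i, x⟩ :: l =>
    1 - massOutside r i + letterHitting r x * (massOutside r i + meanCancellation r l)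

/-- The mean, over infinite words `ξ` with the Markovian multiplicative law attached to `r`, of
the horofunction `|h⁻¹ * ξ| - |ξ|`. -/
def meanHorofunction (r : Letter G → ℝ) (h : CoprodI G) : ℝ :=
  wordLength h - meanCancellation r (normalForm h)

/-- For a solution `r` of the traffic equations and an element `w` whose last letter belongs to
`G j`, `coneProb r j (g⁻¹ * w)` is the probability that the limit word of the walk started at `g`
begins with `w`. Outside this cone, that is, when the normal form of `w⁻¹ * g` begins in `G j`,
the walk has to visit `w` in order to enter; inside, it has to visit `w` in order to leave. -/
def coneProb (r : Letter G → ℝ) (j : ι) (h : CoprodI G) : ℝ :=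
  if headFactor h⁻¹ = some j then hitting r h * massOutside r j
  else 1 - hitting r h * (1 - massOutside r j)

lemma coneProb_of_self (hi : massOutside r i ≠ 0) {y : G i} (hy : y ≠ 1) :
    coneProb r i (CoprodI.of y) = factorWeight r y := by
  rw [coneProb, if_pos (headFactor_of_inv hy), hitting_of hi, mul_comm,
    massOutside_mul_letterHitting hi]

lemma coneProb_of_ne (hi : massOutside r i ≠ 0) (hij : i ≠ j) {y : G i} (hy : y ≠ 1) :
    coneProb r j (CoprodI.of y) = 1 - letterHitting r y * (1 - massOutside r j) := by
  rw [coneProb, headFactor_of_inv hy, if_neg (by simpa using hij), hitting_of hi]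

lemma sum_hitting_of_mul_of (hr : ∀ i, massOutside r i ≠ 0) (hsum : HasSum r 1) {y : G i}
    (hy : y ≠ 1) (j : ι) [Fintype (G j)] :
    massOutside r j * ∑ x : G j, hitting r (CoprodI.of y * CoprodI.of x) =
      massOutside r j * hitting r (CoprodI.of y) + 1 - coneProb r j (CoprodI.of y) := by
  have sum_factorWeight : ∑ x : G j, factorWeight r x = 1 :=
    (hasSum_fintype _).unique (hasSum_factorWeight hsum j)
  rw [Finset.mul_sum]
  rcases eq_or_ne i j with rfl | hij
  · simp only [← map_mul, hitting_of (hr i), massOutside_mul_letterHitting (hr i)]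
    rw [(Group.mulLeft_bijective y).sum_comp (factorWeight r), sum_factorWeight,
      coneProb_of_self (hr i) hy, add_sub_cancel_left]
  · have hne : headFactor (CoprodI.of y)⁻¹ ≠ some j := by simpa [headFactor_of_inv hy]
    simp only [hitting_mul_of (hr j) _ hne, mul_left_comm (massOutside r j),
      massOutside_mul_letterHitting (hr j)]
    rw [← Finset.mul_sum, sum_factorWeight, coneProb_of_ne (hr i) hij hy, hitting_of (hr i)]
    ring

lemma meanHorofunction_of_mul (hi : massOutside r i ≠ 0) (y : G i) (ht : headFactor t ≠ some i) :
    meanHorofunction r (CoprodI.of y * t) = wordLength t + massOutside r i -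
      letterHitting r y * (massOutside r i + meanCancellation r (normalForm t)) := by
  by_cases hy : y = 1
  · rw [hy, map_one, one_mul, letterHitting_one hi, meanHorofunction]
    ring
  · rw [meanHorofunction, wordLength_of_mul hy ht, normalForm_of_mul hy ht, meanCancellation]
    push_cast
    ring

lemma meanHorofunction_one : meanHorofunction r (1 : CoprodI G) = 0 := by
  simp [meanHorofunction, meanCancellation]

lemma meanHorofunction_of (hi : massOutside r i ≠ 0) (y : G i) :
    meanHorofunction r (CoprodI.of y) = massOutside r i - factorWeight r y := by
  have := meanHorofunction_of_mul hi y (t := 1) (by simp)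
  rw [mul_one] at this
  rw [this, ← massOutside_mul_letterHitting hi]
  simp only [wordLength_one, normalForm_one, meanCancellation]
  push_cast
  ring

lemma meanHorofunction_of_mul_of_mul (hr : ∀ i, massOutside r i ≠ 0) {y : G j} (hy : y ≠ 1)
    {x : G i} (hx : x ≠ 1) (ht : headFactor t ≠ some i) :
    meanHorofunction r (CoprodI.of y * (CoprodI.of x * t)) =
      wordLength t + coneProb r i (CoprodI.of y) + meanHorofunction r (CoprodI.of y) -
        hitting r (CoprodI.of y * CoprodI.of x) *
          (massOutside r i + meanCancellation r (normalForm t)) := by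
  rw [meanHorofunction_of (hr j), ← massOutside_mul_letterHitting (hr j)]
  rcases eq_or_ne j i with rfl | hji
  · rw [← mul_assoc, ← map_mul, meanHorofunction_of_mul (hr j) _ ht, hitting_of (hr j),
      coneProb_of_self (hr j) hy, massOutside_mul_letterHitting (hr j)]
    ring
  · have hne : headFactor (CoprodI.of x * t) ≠ some j := by
      simpa [headFactor_of_mul hx ht] using hji.symm
    have hlast : headFactor (CoprodI.of y)⁻¹ ≠ some i := by simpa [headFactor_of_inv hy]
    rw [meanHorofunction_of_mul (hr j) y hne, wordLength_of_mul hx ht, normalForm_of_mul hx ht,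
      meanCancellation, hitting_mul_of (hr i) x hlast, hitting_of (hr j),
      coneProb_of_ne (hr j) hji hy]
    push_cast
    ring

end HittingWeight

variable [DecidableEq ι]

/-- A positive probability vector `r` solves the traffic equations of the step law `μ` when
`hitting r` is harmonic at the words of length one. The inequality says that the probability
`letterHitting r u` of ever visiting the letter `u` is less than one. -/
structure IsTrafficSolution (μ : Measure (CoprodI G)) (r : Letter G → ℝ) : Prop where
  pos (u : Letter G) : 0 < r u
  hasSum : HasSum r 1
  lt_massOutside (u : Letter G) : r u < massOutside r u.factor
  integral_hitting (u : Letter G) :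
    ∫ s, hitting r (s⁻¹ * u.toGroup) ∂μ = hitting r u.toGroup

end TrafficEquations

lemma integrable_of_ae_mem_finite {α : Type*} [MeasurableSpace α] [DiscreteMeasurableSpace α]
    {μ : Measure α} [IsFiniteMeasure μ] {s : Set α} (hs : s.Finite) (hμ : ∀ᵐ x ∂μ, x ∈ s)
    (f : α → ℝ) : Integrable f μ := by
  obtain ⟨C, hC⟩ := (hs.image fun x => ‖f x‖).bddAbove
  refine .of_bound Measurable.of_discrete.aestronglyMeasurable C ?_
  filter_upwards [hμ] with x hx using hC ⟨x, hx, rfl⟩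

lemma integrable_of_ae_letter {ι : Type} {G : ι → Type} [∀ i, Group (G i)] [Finite ι]
    [∀ i, Finite (G i)] {μ : Measure (CoprodI G)} [IsFiniteMeasure μ]
    (hμ : ∀ᵐ s ∂μ, s ∈ range Letter.toGroup) (f : CoprodI G → ℝ) : Integrable f μ := by
  have : Finite (Letter G) := inferInstanceAs (Finite {x : Σ i, G i // x.2 ≠ 1})
  exact integrable_of_ae_mem_finite (finite_range _) hμ f

namespace IsTrafficSolution

variable {ι : Type} [DecidableEq ι] {G : ι → Type} [∀ i, Group (G i)] [∀ i, DecidableEq (G i)]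
  {μ : Measure (CoprodI G)} {r : Letter G → ℝ} {i j : ι} {g h w : CoprodI G}
  (hr : IsTrafficSolution μ r)
include hr

lemma massOutside_pos (i : ι) : 0 < massOutside r i := by
  by_contra! hi
  refine one_pos.not_ge (hasSum_le (fun x => ?_) (hasSum_factorWeight hr.hasSum i) hasSum_zero)
  by_cases hx : x = 1
  · rwa [hx, factorWeight_one]
  · exact absurd ((hr.pos _).trans (hr.lt_massOutside ⟨⟨i, x⟩, hx⟩)) hi.not_gt

lemma massOutside_ne (i : ι) : massOutside r i ≠ 0 := (hr.massOutside_pos i).ne'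

lemma factorWeight_pos (x : G i) : 0 < factorWeight r x := by
  rw [factorWeight]
  split_ifs
  exacts [hr.massOutside_pos i, hr.pos _]

lemma massOutside_le_one (i : ι) : massOutside r i ≤ 1 := by
  rw [← factorWeight_one]
  exact le_hasSum (hasSum_factorWeight hr.hasSum i) 1 fun x _ => (hr.factorWeight_pos x).le

lemma letterHitting_pos (x : G i) : 0 < letterHitting r x :=
  div_pos (hr.factorWeight_pos x) (hr.massOutside_pos i)

section Harmonic

lemma integral_hitting_mul_of {x : G i} (hx : x ≠ 1) :
    ∫ s, hitting r (s⁻¹ * CoprodI.of x) ∂μ = letterHitting r x := by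
  rw [← hitting_of (hr.massOutside_ne i)]
  exact hr.integral_hitting ⟨⟨i, x⟩, hx⟩

lemma integral_hitting_of_ne_one (hμ : ∀ᵐ s ∂μ, s ∈ range Letter.toGroup) (hh : h ≠ 1) :
    ∫ s, hitting r (s⁻¹ * h) ∂μ = hitting r h := by
  induction h using normalForm_induction with
  | one => exact absurd rfl hh
  | of_mul i x t hx ht =>
    have split_off : ∀ᵐ s ∂μ, hitting r (s⁻¹ * (CoprodI.of x * t)) =
        hitting r (s⁻¹ * CoprodI.of x) * hitting r t := by
      filter_upwards [hμ]
      rintro _ ⟨u, rfl⟩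
      rw [Letter.toGroup, ← map_inv]
      exact hitting_of_mul_of_mul hr.massOutside_ne _ hx ht
    rw [integral_congr_ae split_off, integral_mul_const, hr.integral_hitting_mul_of hx,
      hitting_of_mul (hr.massOutside_ne i) x ht]

variable [Finite ι] [∀ i, Finite (G i)]

variable [IsProbabilityMeasure μ] (hμ : ∀ᵐ s ∂μ, s ∈ range Letter.toGroup)
include hμ

lemma integral_coneProb_inv (j : ι) : ∫ s, coneProb r j s⁻¹ ∂μ = massOutside r j := by
  have := Fintype.ofFinite (G j)
  have integrable (f : CoprodI G → ℝ) : Integrable f μ := integrable_of_ae_letter hμ f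
  have integral_hitting_of (x : G j) :
      massOutside r j * ∫ s, hitting r (s⁻¹ * CoprodI.of x) ∂μ = factorWeight r x +
        if x = 1 then massOutside r j * ∫ s, hitting r s⁻¹ ∂μ - massOutside r j else 0 := by
    split_ifs with hx
    · simp [hx, factorWeight_one]
    · rw [hr.integral_hitting_mul_of hx, massOutside_mul_letterHitting (hr.massOutside_ne j),
        add_zero]
  have sum_factorWeight : ∑ x : G j, factorWeight r x = 1 :=
    (hasSum_fintype _).unique (hasSum_factorWeight hr.hasSum j)
  have total : ∫ s, massOutside r j * ∑ x : G j, hitting r (s⁻¹ * CoprodI.of x) ∂μ =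
      1 + (massOutside r j * ∫ s, hitting r s⁻¹ ∂μ - massOutside r j) := by
    rw [integral_const_mul, integral_finsetSum _ fun x _ => integrable _, Finset.mul_sum,
      Finset.sum_congr rfl fun x _ => integral_hitting_of x, Finset.sum_add_distrib,
      sum_factorWeight, Finset.sum_ite_eq' _ _ _, if_pos (Finset.mem_univ _)]
  have pointwise : ∀ᵐ s ∂μ, massOutside r j * ∑ x : G j, hitting r (s⁻¹ * CoprodI.of x) =
      massOutside r j * hitting r s⁻¹ + 1 - coneProb r j s⁻¹ := by
    filter_upwards [hμ]
    rintro _ ⟨u, rfl⟩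
    rw [Letter.toGroup, ← map_inv]
    exact sum_hitting_of_mul_of hr.massOutside_ne hr.hasSum (inv_ne_one.2 u.2) j
  rw [integral_congr_ae pointwise, integral_sub (integrable _) (integrable _),
    integral_add (integrable _) (integrable_const _), integral_const_mul,
    integral_const, probReal_univ, one_smul] at total
  linarith

lemma integral_coneProb (j : ι) (h : CoprodI G) :
    ∫ s, coneProb r j (s⁻¹ * h) ∂μ = coneProb r j h := by
  by_cases hh : h = 1
  · simpa [hh, coneProb] using hr.integral_coneProb_inv hμ j
  · have same_branch : ∀ᵐ s ∂μ, coneProb r j (s⁻¹ * h) =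
        if headFactor h⁻¹ = some j then hitting r (s⁻¹ * h) * massOutside r j
        else 1 - hitting r (s⁻¹ * h) * (1 - massOutside r j) := by
      filter_upwards [hμ]
      rintro _ ⟨u, rfl⟩
      rw [coneProb, mul_inv_rev, inv_inv]
      rcases headFactor_mul_of (inv_ne_one.2 hh) u.1.2 with heq | heq
      · rw [Letter.toGroup, heq]
      · rw [inv_mul_eq_one.1 heq, Letter.toGroup]
        simp
    rw [integral_congr_ae same_branch, coneProb]
    split_ifs
    · rw [integral_mul_const, hr.integral_hitting_of_ne_one hμ hh]
    · rw [integral_sub (integrable_const _) (integrable_of_ae_letter hμ _), integral_mul_const,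
        hr.integral_hitting_of_ne_one hμ hh]
      simp

lemma integral_meanHorofunction (h : CoprodI G) :
    ∫ s, meanHorofunction r (s⁻¹ * h) ∂μ =
      meanHorofunction r h + ∫ s, meanHorofunction r s⁻¹ ∂μ := by
  have integrable (f : CoprodI G → ℝ) : Integrable f μ := integrable_of_ae_letter hμ f
  induction h using normalForm_induction with
  | one => simp [meanHorofunction_one]
  | of_mul i x t hx ht =>
    have expand : ∀ᵐ s ∂μ, meanHorofunction r (s⁻¹ * (CoprodI.of x * t)) =
        wordLength t + coneProb r i s⁻¹ + meanHorofunction r s⁻¹ -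
          hitting r (s⁻¹ * CoprodI.of x) *
            (massOutside r i + meanCancellation r (normalForm t)) := by
      filter_upwards [hμ]
      rintro _ ⟨u, rfl⟩
      rw [Letter.toGroup, ← map_inv]
      exact meanHorofunction_of_mul_of_mul hr.massOutside_ne (inv_ne_one.2 u.2) hx ht
    rw [integral_congr_ae expand, integral_sub (integrable _) (integrable _),
      integral_add (integrable _) (integrable _),
      integral_add (integrable_const _) (integrable _), hr.integral_coneProb_inv hμ,
      integral_mul_const, hr.integral_hitting_mul_of hx,
      meanHorofunction_of_mul (hr.massOutside_ne i) x ht]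
    simp only [integral_const, probReal_univ, one_smul]
    ring

end Harmonic

end IsTrafficSolution

/-! ### Harmonic measure and drift -/

section HarmonicMeasure

variable {ι : Type} [DecidableEq ι] {G : ι → Type} [∀ i, Group (G i)] [∀ i, DecidableEq (G i)]

/-- The infinite words that begin with the normal form of `w`. -/
def cone (w : CoprodI G) : Set (ℕ → Letter G) :=
  {ξ | ∀ m (hm : m < (normalForm w).length), (ξ m).1 = (normalForm w)[m]}

lemma measurableSet_cone (w : CoprodI G) : MeasurableSet (cone w) := by
  have : cone w = ⋂ m, ⋂ hm : m < (normalForm w).length,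
      (fun ξ : ℕ → Letter G => ξ m) ⁻¹' {u | u.1 = (normalForm w)[m]} := by
    ext ξ
    simp [cone]
  rw [this]
  exact .iInter fun m => .iInter fun _ => measurable_pi_apply m .of_discrete

lemma mem_cone_walk_iff {u ξ : ℕ → Letter G} {n : ℕ}
    (hu : ∀ j < n, (u j).factor ≠ (u (j + 1)).factor) :
    ξ ∈ cone (walk (fun j => (u j).toGroup) (n + 1)) ↔ ∀ j ≤ n, ξ j = u j := by
  simp only [cone, mem_ofPred_eq, normalForm_walk_toGroup hu, List.length_map, List.length_range,
    List.getElem_map, List.getElem_range, Nat.lt_succ_iff]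
  exact forall₂_congr fun j _ => Subtype.ext_iff.symm

lemma TendsToInfiniteWord.tendsto_wordLength {X : ℕ → CoprodI G} {ξ : ℕ → Letter G}
    (h : TendsToInfiniteWord X ξ) : Tendsto (fun n => wordLength (X n)) atTop atTop :=
  tendsto_atTop.2 fun m => (h m).mono fun _ hn => (List.getElem?_eq_some_iff.1 hn).1.le

lemma mul_prod_transition {r : Letter G → ℝ} (hr : ∀ i, massOutside r i ≠ 0) {u : ℕ → Letter G}
    {n : ℕ} (hu : ∀ j < n, (u j).factor ≠ (u (j + 1)).factor) :
    r (u 0) * ∏ j ∈ Finset.range n, transition r (u j) (u (j + 1)) =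
      hitting r (walk (fun j => (u j).toGroup) (n + 1)) * massOutside r (u n).factor := by
  have letter (v : Letter G) : massOutside r v.factor * letterHitting r v.1.2 = r v :=
    (massOutside_mul_letterHitting (hr _) _).trans (factorWeight_letter v)
  induction n with
  | zero => simp [walk, Letter.toGroup, hitting_of (hr _), mul_comm, ← letter]
  | succ n ih =>
    have hitting_walk : hitting r (walk (fun j => (u j).toGroup) (n + 2)) =
        hitting r (walk (fun j => (u j).toGroup) (n + 1)) * letterHitting r (u (n + 1)).1.2 := by
      refine hitting_mul_of (hr _) _ ?_
      rw [headFactor_walk_toGroup_inv fun j hj => hu j (by omega), Ne, Option.some_inj]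
      exact hu n (by omega)
    rw [Finset.prod_range_succ, ← mul_assoc, ih fun j hj => hu j (by omega), transition,
      if_neg (hu n (by omega)).symm, ← massOutside, mul_assoc, mul_div_cancel₀ _ (hr _),
      hitting_walk, mul_assoc, mul_comm (letterHitting _ _), letter]

namespace IsTrafficSolution

variable {μ : Measure (CoprodI G)} {r : Letter G → ℝ} {i j : ι} {w : CoprodI G} {θ : ℝ}
  (hr : IsTrafficSolution μ r)
include hr

lemma letterHitting_lt_one (u : Letter G) : letterHitting r u.1.2 < 1 := by
  rw [letterHitting_letter, div_lt_one (hr.massOutside_pos _)]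
  exact hr.lt_massOutside u

lemma hitting_pos (g : CoprodI G) : 0 < hitting r g := by
  refine List.prod_pos fun q hq => ?_
  obtain ⟨x, -, rfl⟩ := List.mem_map.1 hq
  exact hr.letterHitting_pos x.2

lemma hitting_le_pow (hθ : ∀ u : Letter G, letterHitting r u.1.2 ≤ θ) (g : CoprodI G) :
    hitting r g ≤ θ ^ wordLength g := by
  induction g using normalForm_induction with
  | one => simp
  | of_mul i x g hx hg ih =>
    have hxθ := hθ ⟨⟨i, x⟩, hx⟩
    rw [hitting_of_mul (hr.massOutside_ne i) x hg, wordLength_of_mul hx hg, pow_succ']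
    exact mul_le_mul hxθ ih (hr.hitting_pos g).le ((hr.letterHitting_pos x).le.trans hxθ)

lemma hitting_le_one (g : CoprodI G) : hitting r g ≤ 1 := by
  simpa using hr.hitting_le_pow (fun u => (hr.letterHitting_lt_one u).le) g

lemma abs_coneProb_le_one (j : ι) (h : CoprodI G) : |coneProb r j h| ≤ 1 := by
  have hit₀ := (hr.hitting_pos h).le
  have hit₁ := hr.hitting_le_one h
  have mass₀ := (hr.massOutside_pos j).le
  have mass₁ := hr.massOutside_le_one j
  rw [coneProb, abs_le]
  split_ifs <;> constructor <;> nlinarith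

lemma meanCancellation_nonneg (l : List (Σ i, G i)) : 0 ≤ meanCancellation r l := by
  induction l with
  | nil => exact le_rfl
  | cons x l ih =>
    have := mul_nonneg (hr.letterHitting_pos x.2).le (add_nonneg (hr.massOutside_pos x.1).le ih)
    have := hr.massOutside_le_one x.1
    rw [meanCancellation]
    linarith

lemma meanCancellation_le (hθ₁ : θ < 1) (hθ : ∀ u : Letter G, letterHitting r u.1.2 ≤ θ)
    (g : CoprodI G) : meanCancellation r (normalForm g) ≤ (1 - θ)⁻¹ := by
  induction g using normalForm_induction with
  | one => simpa [meanCancellation] using hθ₁.le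
  | of_mul i x g hx hg ih =>
    have hxθ := hθ ⟨⟨i, x⟩, hx⟩
    have fixed_point : (1 - θ) * (1 - θ)⁻¹ = 1 := mul_inv_cancel₀ (sub_pos.2 hθ₁).ne'
    rw [normalForm_of_mul hx hg, meanCancellation]
    calc 1 - massOutside r i +
          letterHitting r x * (massOutside r i + meanCancellation r (normalForm g))
        ≤ 1 - massOutside r i + (massOutside r i + θ * (1 - θ)⁻¹) := by
          rw [mul_add]
          gcongr
          · exact mul_le_of_le_one_left (hr.massOutside_pos i).le (hxθ.trans hθ₁.le)
          · exact hr.meanCancellation_nonneg _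
          · exact (hr.letterHitting_pos x).le.trans hxθ
      _ = (1 - θ)⁻¹ := by linarith

variable [Finite ι] [∀ i, Finite (G i)]

lemma exists_letterHitting_le :
    ∃ θ ∈ Ioo (0 : ℝ) 1, ∀ u : Letter G, letterHitting r u.1.2 ≤ θ := by
  have : Finite (Letter G) := inferInstanceAs (Finite {x : Σ i, G i // x.2 ≠ 1})
  have below_one : ∀ᶠ θ in 𝓝[<] (1 : ℝ), ∀ u : Letter G, letterHitting r u.1.2 ≤ θ :=
    eventually_all.2 fun u => mem_of_superset (Ioo_mem_nhdsLT (hr.letterHitting_lt_one u))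
      fun θ hθ => hθ.1.le
  obtain ⟨θ, hmem, hθ⟩ := (Filter.Eventually.and (Ioo_mem_nhdsLT one_pos) below_one).exists
  exact ⟨θ, hmem, hθ⟩

lemma tendsto_hitting {X : ℕ → CoprodI G} {ξ : ℕ → Letter G} (h : TendsToInfiniteWord X ξ)
    (w : CoprodI G) : Tendsto (fun n => hitting r ((X n)⁻¹ * w)) atTop (𝓝 0) := by
  obtain ⟨θ, ⟨hθ₀, hθ₁⟩, hθ⟩ := hr.exists_letterHitting_le
  have length_le (n : ℕ) : wordLength (X n) - wordLength w ≤ wordLength ((X n)⁻¹ * w) := by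
    have := wordLength_mul_le ((X n)⁻¹ * w) w⁻¹
    rw [mul_inv_cancel_right, wordLength_inv, wordLength_inv] at this
    exact Nat.sub_le_of_le_add this
  have length_atTop := tendsto_atTop_mono length_le
    ((tendsto_sub_atTop_nat (wordLength w)).comp h.tendsto_wordLength)
  exact squeeze_zero (fun n => (hr.hitting_pos _).le) (fun n => hr.hitting_le_pow hθ _)
    ((tendsto_pow_atTop_nhds_zero_of_lt_one hθ₀.le hθ₁).comp length_atTop)

lemma tendsto_coneProb (hw : headFactor w⁻¹ = some j) {X : ℕ → CoprodI G} {ξ : ℕ → Letter G}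
    (h : TendsToInfiniteWord X ξ) :
    Tendsto (fun n => coneProb r j ((X n)⁻¹ * w)) atTop (𝓝 ((cone w).indicator 1 ξ)) := by
  have hw₁ : w ≠ 1 := by
    rintro rfl
    simp at hw
  have branch : ∀ᶠ n in atTop, headFactor ((X n)⁻¹ * w)⁻¹ = some j ↔ ξ ∉ cone w := by
    filter_upwards [h.eventually_prefix_iff (normalForm w)] with n hn
    rw [mul_inv_rev, inv_inv, ← hw, cone, mem_ofPred_eq, ← hn, normalForm_prefix_iff hw₁, not_not]
  by_cases hξ : ξ ∈ cone w
  · have := ((hr.tendsto_hitting h w).mul_const (1 - massOutside r j)).const_sub 1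
    rw [zero_mul, sub_zero] at this
    rw [indicator_of_mem hξ]
    refine this.congr' ?_
    filter_upwards [branch] with n hn
    rw [coneProb, if_neg (hn.not.2 (not_not.2 hξ))]
  · have := (hr.tendsto_hitting h w).mul_const (massOutside r j)
    rw [zero_mul] at this
    rw [indicator_of_notMem hξ]
    refine this.congr' ?_
    filter_upwards [branch] with n hn
    rw [coneProb, if_pos (hn.2 hξ)]

variable [IsProbabilityMeasure μ] (hμ : ∀ᵐ s ∂μ, s ∈ range Letter.toGroup)
include hμ

theorem hasDrift : HasDrift μ (∫ s, meanHorofunction r s⁻¹ ∂μ) := by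
  obtain ⟨θ, ⟨-, hθ₁⟩, hθ⟩ := hr.exists_letterHitting_le
  refine hasDrift_of_potential hμ (Φ := fun g => meanHorofunction r g⁻¹) (C := (1 - θ)⁻¹)
    (by simp [meanHorofunction_one]) (fun g => ?_) fun g => ?_
  · rw [integral_sub (integrable_of_ae_letter hμ _) (integrable_const _)]
    simp only [mul_inv_rev, hr.integral_meanHorofunction hμ, integral_const, probReal_univ,
      one_smul]
    ring
  · rw [meanHorofunction, wordLength_inv, sub_sub_cancel_left, abs_neg,
      abs_of_nonneg (hr.meanCancellation_nonneg _)]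
    exact hr.meanCancellation_le hθ₁ hθ _

variable {Xinf : (ℕ → CoprodI G) → ℕ → Letter G} (hmeas : Measurable Xinf)
  (hlim : ∀ᵐ ω ∂(incrementLaw μ), TendsToInfiniteWord (walk ω) (Xinf ω))
include hmeas hlim

lemma measureReal_cone (hw : headFactor w⁻¹ = some j) :
    ((incrementLaw μ).map Xinf).real (cone w) = hitting r w * massOutside r j := by
  rw [map_measureReal_apply hmeas (measurableSet_cone w)]
  have := measureReal_eq_of_harmonic (μ := μ) (H := fun g => coneProb r j (g⁻¹ * w)) (C := 1)
    (fun g => hr.abs_coneProb_le_one j _) (fun g => ?_) (hmeas (measurableSet_cone w)) ?_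
  · rwa [inv_one, one_mul, coneProb, if_pos hw] at this
  · simp only [mul_inv_rev, mul_assoc, hr.integral_coneProb hμ]
  · filter_upwards [hlim] with ω hω
    exact hr.tendsto_coneProb hw hω

theorem isMarkovianMultiplicative :
    IsMarkovianMultiplicative r ((incrementLaw μ).map Xinf) := by
  refine ⟨hr.pos, hr.hasSum, Measure.isProbabilityMeasure_map hmeas.aemeasurable, fun n u => ?_⟩
  have := Measure.isProbabilityMeasure_map (μ := incrementLaw μ) hmeas.aemeasurable
  by_cases hu : ∀ j < n, (u j).factor ≠ (u (j + 1)).factor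
  · have cylinder : {ξ | ∀ j ≤ n, ξ j = u j} = cone (walk (fun j => (u j).toGroup) (n + 1)) :=
      Set.ext fun ξ => (mem_cone_walk_iff hu).symm
    rw [cylinder, ← ofReal_measureReal, mul_prod_transition hr.massOutside_ne hu,
      hr.measureReal_cone hμ hmeas hlim (headFactor_walk_toGroup_inv hu)]
  · push Not at hu
    obtain ⟨m, hm, heq⟩ := hu
    have cylinder_measurable : MeasurableSet ((Iic n).pi fun j => {u j}) :=
      .pi (to_countable _) fun _ _ => .of_discrete
    have no_jump : transition r (u m) (u (m + 1)) = 0 := if_pos heq.symm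
    rw [Finset.prod_eq_zero (Finset.mem_range.2 hm) no_jump, mul_zero, ENNReal.ofReal_zero]
    refine (Measure.map_apply hmeas cylinder_measurable).trans
      (measure_eq_zero_iff_ae_notMem.2 ?_)
    filter_upwards [hlim] with ω hω hmem
    apply hω.factor_ne m
    rw [hmem m hm.le, hmem (m + 1) hm, heq]

omit hmeas hlim in
theorem exists_isHarmonicMeasure (hdrift : 0 < ∫ s, meanHorofunction r s⁻¹ ∂μ) :
    ∃ ν, IsHarmonicMeasure μ ν ∧ IsMarkovianMultiplicative r ν := by
  have : Nonempty (Letter G) := by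
    by_contra! hempty
    exact one_ne_zero (hr.hasSum.unique (hasSum_empty (f := r)))
  obtain ⟨Xinf, hmeas, hlim⟩ := exists_measurable_limit
    (ae_exists_tendsToInfiniteWord hμ (hr.hasDrift hμ) hdrift)
  exact ⟨_, ⟨Xinf, hmeas, hlim, rfl⟩, hr.isMarkovianMultiplicative hμ hmeas hlim⟩

end IsTrafficSolution

end HarmonicMeasure

/-! ### Hecke groups -/

section HeckeWalk

variable {k : ℕ} {y : ℝ}

/-- The generator of the cyclic factor `i`: `a` for `i = false` and `b` for `i = true`. -/
def factorGen (k : ℕ) (i : Bool) : HeckeFactor k i := Multiplicative.ofAdd 1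

lemma eq_factorGen_false {x : HeckeFactor k false} (hx : x ≠ 1) : x = factorGen k false := by
  have : ∀ x : Multiplicative (ZMod 2), x ≠ 1 → x = Multiplicative.ofAdd 1 := by decide
  exact this x hx

lemma factorGen_ne_one (hk : 1 < k) (i : Bool) : factorGen k i ≠ 1 := by
  have : Fact (1 < heckeOrder k i) := ⟨by cases i; exacts [one_lt_two, hk]⟩
  exact one_ne_zero (α := ZMod (heckeOrder k i))

instance instNeZeroHeckeOrder [NeZero k] (i : Bool) : NeZero (heckeOrder k i) := by
  cases i
  exacts [⟨two_ne_zero⟩, ‹_›]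

lemma integral_heckeStep (f : HeckeGroup k → ℝ) : ∫ s, f s ∂(heckeStep k) =
    (f (CoprodI.of (factorGen k false)) + f (CoprodI.of (factorGen k true)) +
      f (CoprodI.of (factorGen k true)⁻¹)) / 3 := by
  have integrable_dirac (g : HeckeGroup k) : Integrable f (.dirac g) :=
    integrable_dirac enorm_lt_top
  rw [heckeStep, integral_smul_measure,
    integral_add_measure ((integrable_dirac _).add_measure (integrable_dirac _))
      (integrable_dirac _),
    integral_add_measure (integrable_dirac _) (integrable_dirac _), integral_dirac,
    integral_dirac, integral_dirac, map_inv, ENNReal.toReal_inv, smul_eq_mul, inv_mul_eq_div]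
  rfl

lemma ae_heckeStep_mem_range (hk : 1 < k) :
    ∀ᵐ s ∂(heckeStep k), s ∈ range (Letter.toGroup (G := HeckeFactor k)) := by
  have of_mem {i : Bool} {x : HeckeFactor k i} (hx : x ≠ 1) :
      CoprodI.of x ∈ range (Letter.toGroup (G := HeckeFactor k)) := ⟨⟨⟨i, x⟩, hx⟩, rfl⟩
  have gen_inv : (genB k)⁻¹ = CoprodI.of (factorGen k true)⁻¹ := (map_inv _ _).symm
  refine Measure.ae_smul_measure ?_ _
  simp only [ae_add_measure_iff, ae_dirac_eq, gen_inv]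
  exact ⟨⟨of_mem (factorGen_ne_one hk false), of_mem (factorGen_ne_one hk true)⟩,
    of_mem (inv_ne_one.2 (factorGen_ne_one hk true))⟩

lemma massOutside_heckeWeight_true : massOutside (heckeWeight k y) true = heckeG 0 y := by
  let a : {w : Letter (HeckeFactor k) // w.factor ≠ true} :=
    ⟨⟨⟨false, factorGen k false⟩, by exact one_ne_zero (α := ZMod 2)⟩, Bool.false_ne_true⟩
  refine tsum_eq_single a fun w hw => (hw ?_).elim
  obtain ⟨⟨⟨i, x⟩, hx⟩, hi⟩ := w
  obtain rfl : i = false := Bool.eq_false_iff.2 hi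
  obtain rfl := eq_factorGen_false hx
  rfl

lemma factorWeight_heckeWeight_true (x : HeckeFactor k true) :
    factorWeight (heckeWeight k y) x = heckeG (Multiplicative.toAdd x).val y := by
  by_cases hx : x = 1
  · rw [hx, factorWeight_one, massOutside_heckeWeight_true, toAdd_one, ZMod.val_zero]
  · exact factorWeight_letter ⟨⟨true, x⟩, hx⟩

lemma letterHitting_heckeWeight_true (x : HeckeFactor k true) :
    letterHitting (heckeWeight k y) x = heckeG (Multiplicative.toAdd x).val y / heckeG 0 y := by
  rw [letterHitting, factorWeight_heckeWeight_true, massOutside_heckeWeight_true]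

lemma factorWeight_heckeWeight_false {x : HeckeFactor k false} (hx : x ≠ 1) :
    factorWeight (heckeWeight k y) x = heckeG 0 y :=
  factorWeight_letter ⟨⟨false, x⟩, hx⟩

lemma sum_zmod_val [NeZero k] (f : ℕ → ℝ) :
    ∑ z : ZMod k, f z.val = ∑ n ∈ Finset.range k, f n := by
  obtain ⟨m, rfl⟩ := Nat.exists_eq_succ_of_ne_zero (NeZero.ne k)
  exact Fin.sum_univ_eq_sum_range f (m + 1)

lemma factorWeight_factorGen_true (hk : 1 < k) :
    factorWeight (heckeWeight k y) (factorGen k true) = y := by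
  have : Fact (1 < k) := ⟨hk⟩
  rw [factorWeight_heckeWeight_true]
  exact congrArg (heckeG · y) (ZMod.val_one k)

lemma factorWeight_factorGen_true_inv (hk : k ≠ 0) (hG : heckeG (k - 1) y = y) :
    factorWeight (heckeWeight k y) (factorGen k true)⁻¹ = y := by
  obtain ⟨m, rfl⟩ := Nat.exists_eq_succ_of_ne_zero hk
  rw [factorWeight_heckeWeight_true]
  exact (congrArg (heckeG · y) (ZMod.val_neg_one m)).trans hG

lemma heckeG_zero_mem_Ioo (hy : y ∈ Ioo 0 (1 / 2)) : heckeG 0 y ∈ Ioo 0 (1 / 2) := by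
  rw [heckeG]
  constructor <;> linarith [hy.1, hy.2]

variable (hk : 3 ≤ k) (hy : y ∈ Ioo 0 (1 / 2)) (hG : heckeG (k - 1) y = y)
include hk hy hG

lemma hasSum_heckeWeight : HasSum (heckeWeight k y) 1 := by
  have : NeZero k := ⟨by omega⟩
  have : Finite (Letter (HeckeFactor k)) :=
    inferInstanceAs (Finite {x : Σ i, HeckeFactor k i // x.2 ≠ 1})
  have sum_eq_one : ∑ x : HeckeFactor k true, factorWeight (heckeWeight k y) x = 1 := by
    simp only [factorWeight_heckeWeight_true]
    rw [← sum_heckeG hk hy hG, ← sum_zmod_val]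
    exact Fintype.sum_equiv (Multiplicative.toAdd (α := ZMod k)) _ _ fun _ => rfl
  have hsum := hasSum_factorWeight (Summable.of_finite (f := heckeWeight k y)).hasSum true
  rw [← sum_eq_one, (hasSum_fintype _).unique hsum]
  exact Summable.of_finite.hasSum

lemma massOutside_heckeWeight_false : massOutside (heckeWeight k y) false = 1 - heckeG 0 y := by
  have : NeZero k := ⟨by omega⟩
  have sum_eq_one : ∑ x : HeckeFactor k false, factorWeight (heckeWeight k y) x = 1 :=
    (hasSum_fintype _).unique (hasSum_factorWeight (hasSum_heckeWeight hk hy hG) false)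
  have gen_ne_one := factorGen_ne_one (k := k) (by omega) false
  rw [Fintype.sum_eq_add 1 (factorGen k false) gen_ne_one.symm
      fun x hx => (hx.2 (eq_factorGen_false hx.1)).elim,
    factorWeight_one, factorWeight_heckeWeight_false gen_ne_one] at sum_eq_one
  exact eq_sub_of_add_eq sum_eq_one

lemma letterHitting_heckeWeight_false {x : HeckeFactor k false} (hx : x ≠ 1) :
    letterHitting (heckeWeight k y) x = heckeG 0 y / (1 - heckeG 0 y) := by
  rw [letterHitting, factorWeight_heckeWeight_false hx, massOutside_heckeWeight_false hk hy hG]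

lemma heckeG_val_add_one (z : ZMod k) : heckeG (z + 1).val y = heckeG (z.val + 1) y := by
  have : Fact (1 < k) := ⟨by omega⟩
  have : NeZero k := ⟨by omega⟩
  rw [ZMod.val_add, ZMod.val_one]
  rcases (Nat.succ_le_iff.2 z.val_lt).eq_or_lt with wrap | lt
  · rw [← Nat.succ_eq_add_one, wrap, Nat.mod_self, heckeG_self hk hy hG]
  · rw [Nat.mod_eq_of_lt lt]

lemma heckeG_val_recursion {z : ZMod k} (hz : z ≠ 0) :
    heckeG (z + 1).val y + heckeG (z - 1).val y =
      8 * (1 - y) / (3 - 2 * y) * heckeG z.val y := by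
  obtain ⟨n, hn⟩ := Nat.exists_eq_succ_of_ne_zero (mt (ZMod.val_eq_zero z).1 hz)
  have : NeZero k := ⟨by omega⟩
  have val_sub_one : (z - 1).val = n := by
    have hnk : n < k := by have := z.val_lt; omega
    rw [← ZMod.val_cast_of_lt hnk, ← ZMod.natCast_zmod_val z, hn]
    push_cast
    rw [add_sub_cancel_right]
  rw [heckeG_val_add_one hk hy hG, val_sub_one, hn, heckeG]
  ring

lemma massOutside_heckeWeight_ne_zero (i : Bool) : massOutside (heckeWeight k y) i ≠ 0 := by
  have := heckeG_zero_mem_Ioo hy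
  cases i
  · rw [massOutside_heckeWeight_false hk hy hG]
    linarith [this.2]
  · exact massOutside_heckeWeight_true.trans_ne this.1.ne'

lemma lt_massOutside_heckeWeight (u : Letter (HeckeFactor k)) :
    heckeWeight k y u < massOutside (heckeWeight k y) u.factor := by
  have : NeZero k := ⟨by omega⟩
  obtain ⟨⟨i, x⟩, hx⟩ := u
  suffices factorWeight (heckeWeight k y) x < massOutside (heckeWeight k y) i by
    rwa [factorWeight, dif_neg hx] at this
  cases i
  · rw [factorWeight_heckeWeight_false hx, massOutside_heckeWeight_false hk hy hG]
    linarith [(heckeG_zero_mem_Ioo hy).2]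
  · rw [factorWeight_heckeWeight_true, massOutside_heckeWeight_true]
    have val_pos : 0 < ZMod.val (n := k) x.toAdd :=
      Nat.pos_of_ne_zero (mt (ZMod.val_eq_zero _).1 hx)
    exact heckeG_lt_heckeG_zero hk hy hG ⟨val_pos, ZMod.val_lt (n := k) _⟩

lemma integral_hitting_factorGen_false :
    ∫ s, hitting (heckeWeight k y) (s⁻¹ * CoprodI.of (factorGen k false)) ∂(heckeStep k) =
      hitting (heckeWeight k y) (CoprodI.of (factorGen k false)) := by
  have gen_ne_one := factorGen_ne_one (k := k) (by omega) false
  have mass_ne := massOutside_heckeWeight_ne_zero hk hy hG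
  have hitting_of_mul_gen (x : HeckeFactor k true) :
      hitting (heckeWeight k y) (CoprodI.of x * CoprodI.of (factorGen k false)) =
        factorWeight (heckeWeight k y) x / heckeG 0 y * (heckeG 0 y / (1 - heckeG 0 y)) := by
    rw [hitting_of_mul (mass_ne true) x (by simp [headFactor_of gen_ne_one]),
      hitting_of (mass_ne false), letterHitting_heckeWeight_false hk hy hG gen_ne_one,
      letterHitting, massOutside_heckeWeight_true]
  simp only [integral_heckeStep, inv_mul_cancel, hitting_one]
  simp only [← map_inv, inv_inv, hitting_of_mul_gen]
  rw [factorWeight_factorGen_true (by omega), factorWeight_factorGen_true_inv (by omega) hG,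
    hitting_of (mass_ne false), letterHitting_heckeWeight_false hk hy hG gen_ne_one]
  obtain ⟨h0, h1⟩ := heckeG_zero_mem_Ioo hy
  have traffic : 4 * heckeG 0 y = 1 + 2 * y := by rw [heckeG]; ring
  have h2 : 1 - heckeG 0 y ≠ 0 := by linarith
  have := h0.ne'
  field_simp
  linarith

lemma integral_hitting_of_true {x : HeckeFactor k true} (hx : x ≠ 1) :
    ∫ s, hitting (heckeWeight k y) (s⁻¹ * CoprodI.of x) ∂(heckeStep k) =
      hitting (heckeWeight k y) (CoprodI.of x) := by
  have inv_gen_ne_one := inv_ne_one.2 (factorGen_ne_one (k := k) (by omega) false)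
  have mass_ne := massOutside_heckeWeight_ne_zero hk hy hG
  have recursion : heckeG (Multiplicative.toAdd ((factorGen k true)⁻¹ * x)).val y +
      heckeG (Multiplicative.toAdd (factorGen k true * x)).val y =
        8 * (1 - y) / (3 - 2 * y) * heckeG (Multiplicative.toAdd x).val y := by
    rw [add_comm, mul_comm, mul_comm _ x, ← div_eq_mul_inv, toAdd_div, toAdd_mul]
    exact heckeG_val_recursion hk hy hG hx
  have ratio : heckeG 0 y / (1 - heckeG 0 y) = 3 - 8 * (1 - y) / (3 - 2 * y) := by
    have denom_ne : 3 - 2 * y ≠ 0 := by linarith [hy.2]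
    have one_sub : 1 - heckeG 0 y = (3 - 2 * y) / 4 := by rw [heckeG]; ring
    rw [one_sub, heckeG, div_div_eq_mul_div, eq_sub_iff_add_eq, ← add_div, div_eq_iff denom_ne]
    ring
  simp only [integral_heckeStep, ← map_inv, inv_inv, ← map_mul]
  rw [hitting_of_mul (mass_ne false) _ (by simp [headFactor_of hx])]
  simp only [hitting_of (mass_ne true), letterHitting_heckeWeight_true,
    letterHitting_heckeWeight_false hk hy hG inv_gen_ne_one]
  rw [add_assoc, ← add_div, recursion, ratio]
  ring

lemma isTrafficSolution_heckeWeight : IsTrafficSolution (heckeStep k) (heckeWeight k y) where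
  pos u := by
    rw [heckeWeight]
    split_ifs <;> exact heckeG_pos hk hy hG _
  hasSum := hasSum_heckeWeight hk hy hG
  lt_massOutside := lt_massOutside_heckeWeight hk hy hG
  integral_hitting := by
    rintro ⟨⟨i, x⟩, hx⟩
    cases i
    · obtain rfl := eq_factorGen_false hx
      exact integral_hitting_factorGen_false hk hy hG
    · exact integral_hitting_of_true hk hy hG hx

lemma integral_meanHorofunction_heckeStep :
    ∫ s, meanHorofunction (heckeWeight k y) s⁻¹ ∂(heckeStep k) = (1 - 2 * y) / 3 := by
  have mass_ne := massOutside_heckeWeight_ne_zero hk hy hG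
  have gen_ne_one := factorGen_ne_one (k := k) (by omega) false
  simp only [integral_heckeStep, ← map_inv, inv_inv, meanHorofunction_of (mass_ne _)]
  rw [factorWeight_heckeWeight_false (inv_ne_one.2 gen_ne_one),
    factorWeight_factorGen_true (by omega), factorWeight_factorGen_true_inv (by omega) hG,
    massOutside_heckeWeight_true, massOutside_heckeWeight_false hk hy hG]
  ring

lemma hasDrift_heckeStep : HasDrift (heckeStep k) ((1 - 2 * y) / 3) := by
  have : NeZero k := ⟨by omega⟩
  rw [← integral_meanHorofunction_heckeStep hk hy hG]
  exact (isTrafficSolution_heckeWeight hk hy hG).hasDrift (ae_heckeStep_mem_range (by omega))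

lemma exists_isHarmonicMeasure_heckeStep :
    ∃ ν, IsHarmonicMeasure (heckeStep k) ν ∧ IsMarkovianMultiplicative (heckeWeight k y) ν := by
  have : NeZero k := ⟨by omega⟩
  refine (isTrafficSolution_heckeWeight hk hy hG).exists_isHarmonicMeasure
    (ae_heckeStep_mem_range (by omega)) ?_
  rw [integral_meanHorofunction_heckeStep hk hy hG]
  linarith [hy.2]

end HeckeWalk

end FreeProductWalk

end

theorem mainTheorem2 :
    ∃ y γ : ℕ → ℝ,
      (∀ k : ℕ, 3 ≤ k →
        (y k ∈ Set.Ioo (0 : ℝ) (1 / 2) ∧ FreeProductWalk.heckeG (k - 1) (y k) = y k) ∧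
        (∀ x ∈ Set.Ioo (0 : ℝ) (1 / 2), FreeProductWalk.heckeG (k - 1) x = x → x = y k) ∧
        (∃ ν : MeasureTheory.Measure
            (ℕ → FreeProductWalk.Letter (FreeProductWalk.HeckeFactor k)),
          FreeProductWalk.IsHarmonicMeasure (FreeProductWalk.heckeStep k) ν ∧
          FreeProductWalk.IsMarkovianMultiplicative (FreeProductWalk.heckeWeight k (y k)) ν) ∧
        FreeProductWalk.HasDrift (FreeProductWalk.heckeStep k) (γ k) ∧
        γ k = (1 - 2 * y k) / 3) ∧
      StrictMonoOn γ (Set.Ici 3) ∧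
      Filter.Tendsto γ Filter.atTop (nhds (2 / 9)) := by
  obtain ⟨y, hy, anti, lim⟩ := FreeProductWalk.exists_heckeG_eq_self
  refine ⟨y, fun k => (1 - 2 * y k) / 3, fun k hk => ?_, ?_, ?_⟩
  · obtain ⟨mem_Ioo, fixed, unique⟩ := hy k hk
    exact ⟨⟨mem_Ioo, fixed⟩, unique,
      FreeProductWalk.exists_isHarmonicMeasure_heckeStep hk mem_Ioo fixed,
      FreeProductWalk.hasDrift_heckeStep hk mem_Ioo fixed, rfl⟩
  · intro k hk m hm hkm
    have : y m < y k := anti hk hm hkm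
    change (1 - 2 * y k) / 3 < (1 - 2 * y m) / 3
    linarith
  · convert ((lim.const_mul 2).const_sub 1).div_const 3 using 2
    norm_num
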